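/- Let $X$ be a non-empty, perfect, second countable compact Hausdorff space and let $E$ be a separable Hilbert $C(X)$-module all of whose fibres $E_x$ ($x\in X$) are infinite-dimensional. **Notation.** For a closed set $F\subset X$ put $E_{|F}:=E/\,\overline{C_0(X\setminus F)E}$ and, for a $C(X)$-algebra $A$, $A_{|F}:=A/\,\overline{C_0(X\setminus F)A}$, both with the quotient topology, and denote by $\zeta\mapsto\zeta_{|F}$, $a\mapsto a_{|F}$ the quotient maps and the induced maps to smaller closed sets; $E_x:=E_{|\{x\}}$, and $\xi_x$ is the image of $\xi$ in $E_x$. Let $\mathcal F(E)=\bigoplus_{m\ge 0}E^{\otimes_{C(X)}m}$ be the full Fock Hilbert $C(X)$-module, let $\ell(\zeta)$ ($\zeta\in E$) be the creation operator, $\ell(\zeta)(\zeta_1\otimes\dots\otimes\zeta_k)=\zeta\otimes\zeta_1\otimes\dots\otimes\zeta_k$, in the algebra of adjointable operators $\mathcal L(\mathcal F(E))$, and let the Pimsner–Toeplitz algebra $\mathcal T(E)\subset\mathcal L(\mathcal F(E))$ be the unital $C^*$-algebra generated by $C(X)$ and the $\ell(\zeta)$. The map $\zeta\mapsto\ell(\zeta)$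 induces $\ell:E_{|F}\to\mathcal T(E)_{|F}$. Let $\alpha$ be the action of the circle on $\mathcal T(E)$ with $\alpha_z(\ell(\zeta))=\ell(z\zeta)$, let $\mathcal T(E)^\alpha$ be its fixed-point algebra, and let $\mathcal T(E)^\alpha{}_{|F}$ be the image of $\mathcal T(E)^\alpha$ in $\mathcal T(E)_{|F}$. A non-zero projection $p$ of a $C^*$-algebra is *properly infinite* if there are $s,t$ in the algebra with $s^*s=t^*t=p$, $ps=s$, $pt=t$ and $s^*t=0$; a unital $C^*$-algebra is properly infinite if its unit is. A unitary $w$ of a unital $C^*$-algebra $A$ is *$K_1$-trivial* if $w\oplus 1$ is homotopic to $1\oplus 1$ among the unitaries of $M_2(A)$. **(1)** There are an integer $m$, closed sets $F_1,\dots,F_m\subset X$ whose interiors cover $X$, and sections $\zeta_1,\dots,\zeta_m\in E$ such that * $\|\zeta_k\|=1$ and $\|(\zeta_k)_x\|=1$ for all $x\in F_k$ and all $k$; * $\mathcal T(E)$ is generated, as a unital $C^*$-algebra, by $\mathcal T(E)^\alpha$ and $\ell(\zeta_1),\dots,\ell(\zeta_m)$; * $(\ell(\zeta_k)\ell(\zeta_k)^*)_{|F_k}$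 and $(1-\ell(\zeta_k)\ell(\zeta_k)^*)_{|F_k}$ are properly infinite projections in $\mathcal T(E)_{|F_k}$ for all $k$. For all $m$, $F_k$, $\zeta_k$ as in (1), put $G_l:=F_1\cup\dots\cup F_l$ and $\bar G_l:=G_l\cap F_{l+1}$ ($1\le l\le m-1$). Then (2) and (3) hold. **(2)** For all $l\in\{1,\dots,m-1\}$ and all $\xi(l)\in E_{|G_l}$ with $\|\xi(l)_y\|=1$ for all $y\in\bar G_l$, there is a unitary $w_l\in\mathcal T(E)_{|\bar G_l}$ such that * (a) $w_l\cdot\ell(\xi(l))_{|\bar G_l}=\ell(\zeta_{l+1})_{|\bar G_l}$; * (b) $w_l$ is $K_1$-trivial. **(3)** Suppose that for all $l\in\{1,\dots,m-1\}$ and all $\xi(l)\in E_{|G_l}$ with $\|\xi(l)_y\|=1$ for all $y\in G_l$, some unitary $w_l\in\mathcal T(E)_{|\bar G_l}$ with (a) and (b) lifts to $\mathcal T(E)^\alpha$ over $F_{l+1}$, i.e. there is a unitary $z_{l+1}\in\mathcal T(E)_{|F_{l+1}}$ belonging to $\mathcal T(E)^\alpha{}_{|F_{l+1}}$ with $(z_{l+1})_{|\bar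 G_l}=w_l$. Then there is a section $\xi\in E$ with $\|\xi_x\|=1$ for all $x\in X$, and the $C^*$-algebra $\mathcal T(E)$ is properly infinite. -/

import Mathlib

open scoped ComplexOrder

noncomputable section

namespace PimsnerToeplitz

section Fock

set_option linter.unusedSectionVars false
variable (X : Type*) (E : Type*) [TopologicalSpace X] [CompactSpace X]
  [NormedAddCommGroup E] [NormedSpace ℂ E] [Module C(X, ℂ) E] [CStarModule C(X, ℂ) E]

/-- The `C(X)`-valued inner products of elementary tensors, an elementary tensor
`ζ₁ ⊗ ⋯ ⊗ ζₖ` being given by the word `[ζ₁, …, ζₖ]` (the empty word is the vacuum):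
`⟪ζ₁ ⊗ ⋯ ⊗ ζₖ, ξ₁ ⊗ ⋯ ⊗ ξₖ⟫ = ⟪ζ₁, ξ₁⟫ ⋯ ⟪ζₖ, ξₖ⟫`, and tensors of different degrees are
orthogonal. -/
def wordInner : List E → List E → C(X, ℂ)
  | [], [] => 1
  | a :: v, b :: w => inner C(X, ℂ) a b * wordInner v w
  | [], _ :: _ => 0
  | _ :: _, [] => 0

/-- The formal `C(X)`-linear combinations of elementary tensors of elements of `E`. -/
abbrev PreFock : Type _ := List E →₀ C(X, ℂ)

variable {E}

/-- The formal elementary tensor of a word, with a coefficient. -/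
abbrev PreFock.single (w : List E) (f : C(X, ℂ)) : PreFock X E := Finsupp.single w f

variable (E)

/-- The semi-inner product `⟪∑ fᵢ vᵢ, ∑ gⱼ wⱼ⟫ = ∑ (star fᵢ) gⱼ ⟪vᵢ, wⱼ⟫`. -/
instance : Inner C(X, ℂ) (PreFock X E) where
  inner u v := Finsupp.sum u fun s f => Finsupp.sum v fun t g => star f * g * wordInner X E s t

/-- The seminorm `‖u‖ = ‖⟪u, u⟫‖ ^ (1 / 2)`. -/
instance : Norm (PreFock X E) where
  norm u := √‖inner C(X, ℂ) u u‖

variable {X E}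

lemma wordInner_star (s t : List E) : star (wordInner X E s t) = wordInner X E t s := by
  induction s generalizing t with
  | nil => cases t <;> simp [wordInner]
  | cons a s ih => cases t <;> simp [wordInner, ih]

lemma gram_posSemidef (x : X) :
    (Matrix.of fun a b : E => inner C(X, ℂ) a b x).PosSemidef := by
  refine ⟨?_, fun c => ?_⟩
  · ext a b
    simp only [Matrix.conjTranspose_apply, Matrix.of_apply]
    rw [← CStarModule.star_inner (A := C(X, ℂ)) b a]; rfl
  · have h := CStarModule.inner_self_nonneg (A := C(X, ℂ)) (x := ∑ a ∈ c.support, c a • a)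
    have h2 := h x
    simp only [CStarModule.inner_sum_right, CStarModule.inner_sum_left,
      CStarModule.inner_smul_left_complex, CStarModule.inner_smul_right_complex] at h2
    simp only [Finsupp.sum, Matrix.of_apply]
    rw [Finset.sum_comm]
    simpa [ContinuousMap.sum_apply, Finset.mul_sum, mul_comm, mul_left_comm, mul_assoc] using h2

lemma wordInner_posSemidef (x : X) :
    (Matrix.of fun s t : List E => wordInner X E s t x).PosSemidef := by
  classical
  let e : List E → ℂ := fun s => if s = [] then 1 else 0
  let hd : List E → E := fun s => s.headD 0
  have he : (Matrix.vecMulVec e (star e)).PosSemidef := by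
    refine ⟨?_, fun c => ?_⟩
    · ext a b
      simp [Matrix.vecMulVec, mul_comm]
    · have : (0 : ℂ) ≤ star (∑ a ∈ c.support, star (e a) * c a) *
        (∑ a ∈ c.support, star (e a) * c a) := star_mul_self_nonneg _
      refine this.trans_eq ?_
      simp only [Finsupp.sum, star_sum, Finset.sum_mul_sum, Matrix.vecMulVec_apply, star_mul',
        star_star, Pi.star_apply]
      refine Finset.sum_congr rfl fun i _ => Finset.sum_congr rfl fun j _ => by ring
  let G : Matrix (List E) (List E) ℂ :=
    (Matrix.of fun a b : E => inner C(X, ℂ) a b x).submatrix hd hd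
  have hG : G.PosSemidef := (gram_posSemidef x).submatrix hd
  let K : ℕ → Matrix (List E) (List E) ℂ := fun n =>
    Nat.rec (Matrix.vecMulVec e (star e))
      (fun _ M => Matrix.vecMulVec e (star e) + G.hadamard (M.submatrix List.tail List.tail)) n
  have hK : ∀ n, (K n).PosSemidef := by
    intro n
    induction n with
    | zero => exact he
    | succ n ih => exact he.add (hG.hadamard (ih.submatrix _))
  have hKe : ∀ n, ∀ s t : List E, s.length ≤ n → t.length ≤ n →
      K n s t = wordInner X E s t x := by
    intro n
    induction n with
    | zero =>
      intro s t hs ht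
      have hs' : s = [] := List.length_eq_zero_iff.1 (by omega)
      have ht' : t = [] := List.length_eq_zero_iff.1 (by omega)
      subst hs' ht'
      simp [K, e, Matrix.vecMulVec, wordInner]
    | succ n ih =>
      intro s t hs ht
      have hstep : K (n + 1) s t = e s * star (e t) + inner C(X, ℂ) (hd s) (hd t) x *
        K n s.tail t.tail := rfl
      rw [hstep]
      cases s with
      | nil => cases t <;> simp [e, hd, wordInner]
      | cons a s =>
        cases t with
        | nil => simp [e, hd, wordInner]
        | cons b t =>
          have := ih s t (by simpa using hs) (by simpa using ht)
          simp [e, hd, wordInner, this]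
  refine ⟨?_, fun c => ?_⟩
  · ext s t
    simp only [Matrix.conjTranspose_apply, Matrix.of_apply]
    rw [← wordInner_star t s]; rfl
  · have := (hK (c.support.sup List.length)).2 c
    refine this.trans_eq ?_
    refine Finset.sum_congr rfl fun i hi => Finset.sum_congr rfl fun j hj => ?_
    have hij := hKe _ i j (Finset.le_sup (f := List.length) hi)
      (Finset.le_sup (f := List.length) hj)
    exact congrArg (fun y => star (c i) * y * c j) hij

namespace PreFock

lemma inner_def (u v : PreFock X E) : inner C(X, ℂ) u v =
    Finsupp.sum u fun s f => Finsupp.sum v fun t g => star f * g * wordInner X E s t := rfl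

lemma inner_single_single (s t : List E) (f g : C(X, ℂ)) :
    inner C(X, ℂ) (single X s f) (single X t g) = star f * g * wordInner X E s t := by
  rw [inner_def, single, single, Finsupp.sum_single_index, Finsupp.sum_single_index] <;> simp

lemma inner_add_right (u v w : PreFock X E) :
    inner C(X, ℂ) u (v + w) = inner C(X, ℂ) u v + inner C(X, ℂ) u w := by
  simp only [inner_def]
  simp only [Finsupp.sum, ← Finset.sum_add_distrib]
  refine Finset.sum_congr rfl fun s _ => ?_
  exact Finsupp.sum_add_index' (h := fun t g => star (u s) * g * wordInner X E s t)
    (fun t => by simp) (fun t f g => by ring)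

lemma inner_smul_right (f : C(X, ℂ)) (u v : PreFock X E) :
    inner C(X, ℂ) u (f • v) = f * inner C(X, ℂ) u v := by
  simp only [inner_def]
  rw [Finsupp.sum, Finsupp.sum, Finset.mul_sum]
  refine Finset.sum_congr rfl fun s _ => ?_
  refine (Finsupp.sum_smul_index' (by simp)).trans ?_
  rw [Finsupp.sum, Finsupp.sum, Finset.mul_sum]
  refine Finset.sum_congr rfl fun t _ => ?_
  simp only [smul_eq_mul]
  ring

lemma inner_star (u v : PreFock X E) : star (inner C(X, ℂ) u v) = inner C(X, ℂ) v u := by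
  simp only [inner_def, Finsupp.sum, star_sum]
  rw [Finset.sum_comm]
  refine Finset.sum_congr rfl fun s _ => Finset.sum_congr rfl fun t _ => ?_
  simp [wordInner_star]
  ring

lemma inner_add_left (u v w : PreFock X E) :
    inner C(X, ℂ) (u + v) w = inner C(X, ℂ) u w + inner C(X, ℂ) v w := by
  rw [← inner_star, inner_add_right, star_add, inner_star, inner_star]

lemma inner_smul_left (f : C(X, ℂ)) (u v : PreFock X E) :
    inner C(X, ℂ) (f • u) v = star f * inner C(X, ℂ) u v := by
  rw [← inner_star, inner_smul_right, star_mul', inner_star]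

lemma inner_self_nonneg (u : PreFock X E) : 0 ≤ inner C(X, ℂ) u u := by
  intro x
  have h := (wordInner_posSemidef (E := E) x).2
    (Finsupp.mapRange (fun f : C(X, ℂ) => f x) (ContinuousMap.zero_apply x) u)
  refine h.trans_eq ?_
  refine (Finsupp.sum_mapRange_index (fun s => by simp)).trans ?_
  change _ = inner C(X, ℂ) u u x
  simp only [inner_def, Finsupp.sum, ContinuousMap.sum_apply]
  refine Finset.sum_congr rfl fun s _ => ?_
  refine (Finsupp.sum_mapRange_index (f := fun f : C(X, ℂ) => f x)
    (h := fun t y => star (u s x) * wordInner X E s t x * y) (fun t => by simp)).trans ?_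
  refine Finset.sum_congr rfl fun t _ => ?_
  simp
  ring

lemma complex_smul (c : ℂ) (u : PreFock X E) : c • u = (algebraMap ℂ C(X, ℂ) c) • u := by
  rw [algebraMap_smul]

/-- The scalar semi-inner product at a point. -/
abbrev core (x : X) : PreInnerProductSpace.Core ℂ (PreFock X E) where
  inner u v := inner C(X, ℂ) u v x
  conj_inner_symm u v := by rw [← inner_star u v]; simp
  re_inner_nonneg u := (Complex.le_def.1 (inner_self_nonneg u x)).1
  add_left u v w := by rw [inner_add_left]; rfl
  smul_left u v c := by
    rw [complex_smul, inner_smul_left]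
    simp

lemma re_inner_self_le (u : PreFock X E) (x : X) :
    (inner C(X, ℂ) u u x).re ≤ ‖inner C(X, ℂ) u u‖ :=
  (Complex.re_le_norm _).trans (ContinuousMap.norm_coe_le_norm _ x)

lemma norm_def (u : PreFock X E) : ‖u‖ = √‖inner C(X, ℂ) u u‖ := rfl

lemma norm_sq (u : PreFock X E) : ‖u‖ ^ 2 = ‖inner C(X, ℂ) u u‖ :=
  Real.sq_sqrt (norm_nonneg _)

lemma norm_inner_le (u v : PreFock X E) : ‖inner C(X, ℂ) u v‖ ≤ ‖u‖ * ‖v‖ := by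
  refine (ContinuousMap.norm_le _ (mul_nonneg (Real.sqrt_nonneg _) (Real.sqrt_nonneg _))).2
    fun x => ?_
  let _ := core (E := E) x
  have h := InnerProductSpace.Core.norm_inner_le_norm (𝕜 := ℂ) (F := PreFock X E) u v
  refine h.trans ?_
  exact mul_le_mul (Real.sqrt_le_sqrt (re_inner_self_le u x))
    (Real.sqrt_le_sqrt (re_inner_self_le v x)) (Real.sqrt_nonneg _) (Real.sqrt_nonneg _)

lemma norm_smul_eq (c : ℂ) (u : PreFock X E) : ‖c • u‖ = ‖c‖ * ‖u‖ := by
  rw [norm_def, norm_def, complex_smul, inner_smul_left, inner_smul_right]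
  have : star (algebraMap ℂ C(X, ℂ) c) * (algebraMap ℂ C(X, ℂ) c * inner C(X, ℂ) u u) =
    (star c * c) • inner C(X, ℂ) u u := by
    ext x
    simp [mul_assoc]
  rw [this, norm_smul, CStarRing.norm_star_mul_self, Real.sqrt_mul (by positivity),
    Real.sqrt_mul_self (norm_nonneg _)]

lemma seminormCore : SeminormedSpace.Core ℂ (PreFock X E) where
  norm_nonneg _ := Real.sqrt_nonneg _
  norm_smul := norm_smul_eq
  norm_triangle u v := by
    have hu : 0 ≤ ‖u‖ := Real.sqrt_nonneg _
    have hv : 0 ≤ ‖v‖ := Real.sqrt_nonneg _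
    have h0 : 0 ≤ ‖u + v‖ := Real.sqrt_nonneg _
    refine (sq_le_sq₀ h0 (by positivity)).1 ?_
    rw [norm_sq, inner_add_left, inner_add_right, inner_add_right]
    calc _ ≤ (‖inner C(X, ℂ) u u‖ + ‖inner C(X, ℂ) u v‖) +
          (‖inner C(X, ℂ) v u‖ + ‖inner C(X, ℂ) v v‖) :=
          (norm_add_le _ _).trans (add_le_add (norm_add_le _ _) (norm_add_le _ _))
      _ ≤ (‖u‖ ^ 2 + ‖u‖ * ‖v‖) + (‖v‖ * ‖u‖ + ‖v‖ ^ 2) := by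
          rw [← norm_sq, ← norm_sq]
          gcongr
          · exact norm_inner_le u v
          · exact norm_inner_le v u
      _ = _ := by ring

end PreFock

instance : SeminormedAddCommGroup (PreFock X E) :=
  SeminormedAddCommGroup.ofCore PreFock.seminormCore

instance : NormedSpace ℂ (PreFock X E) where
  norm_smul_le c u := by
    have h := PreFock.norm_smul_eq c u
    exact h.le

instance : IsBoundedSMul C(X, ℂ) (PreFock X E) :=
  IsBoundedSMul.of_norm_smul_le fun f u => by
    have h0 : 0 ≤ ‖f • u‖ := Real.sqrt_nonneg _
    refine (sq_le_sq₀ h0 (by positivity)).1 ?_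
    rw [PreFock.norm_sq, PreFock.inner_smul_left, PreFock.inner_smul_right, ← mul_assoc]
    refine (norm_mul_le _ _).trans ?_
    rw [CStarRing.norm_star_mul_self, mul_pow, PreFock.norm_sq, pow_two]

variable (X E) in
/-- The full Fock Hilbert `C(X)`-module `𝓕(E) = ⨁ₘ E^{⊗ m}`: the (separated) completion of the
formal combinations of elementary tensors for the above semi-inner product. -/
abbrev Fock : Type _ := UniformSpace.Completion (PreFock X E)

namespace Fock

open UniformSpace

lemma continuous_preInner :
    Continuous fun p : PreFock X E × PreFock X E => inner C(X, ℂ) p.1 p.2 := by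
  let B : PreFock X E →ₗ⋆[ℂ] PreFock X E →ₗ[ℂ] C(X, ℂ) :=
    LinearMap.mk₂'ₛₗ (starRingEnd ℂ) (RingHom.id ℂ) (fun u v => inner C(X, ℂ) u v)
      PreFock.inner_add_left
      (fun c u v => by
        rw [PreFock.complex_smul, PreFock.inner_smul_left]
        ext x
        simp)
      PreFock.inner_add_right
      (fun c u v => by
        rw [PreFock.complex_smul, PreFock.inner_smul_right]
        ext x
        simp)
  let L := LinearMap.mkContinuous₂ B 1 fun u v => by
    simpa [B] using PreFock.norm_inner_le u v
  have h : Continuous fun p : PreFock X E × PreFock X E => L p.1 p.2 :=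
    (L.continuous.comp continuous_fst).clm_apply continuous_snd
  exact h

lemma inner_coe (u v : PreFock X E) :
    inner C(X, ℂ) (u : Fock X E) (v : Fock X E) = inner C(X, ℂ) u v :=
  (Completion.isDenseInducing_coe.prodMap Completion.isDenseInducing_coe).extend_eq
    (f := Function.uncurry (inner C(X, ℂ))) continuous_preInner (u, v)

lemma continuous_inner' :
    Continuous (Function.uncurry (inner C(X, ℂ) (E := Fock X E))) := by
  let B : PreFock X E →+ PreFock X E →+ C(X, ℂ) :=
    { toFun := fun u =>
        { toFun := fun v => inner C(X, ℂ) u v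
          map_zero' := by
            have := PreFock.inner_smul_right 0 u 0
            simpa using this
          map_add' := PreFock.inner_add_right u }
      map_zero' := by
        refine AddMonoidHom.ext fun v => ?_
        have := PreFock.inner_smul_left 0 0 v
        simpa using this
      map_add' := fun u v => by
        refine AddMonoidHom.ext fun w => ?_
        exact PreFock.inner_add_left u v w }
  have : Continuous fun p : PreFock X E × PreFock X E => B p.1 p.2 := continuous_preInner
  rw [Completion.toInner, inner, Function.uncurry_curry _]
  change
    Continuous
      (((Completion.isDenseInducing_toCompl (PreFock X E)).prodMap
        (Completion.isDenseInducing_toCompl (PreFock X E))).extend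
          fun p : PreFock X E × PreFock X E => B p.1 p.2)
  exact (Completion.isDenseInducing_toCompl (PreFock X E)).extend_Z_bilin
    (Completion.isDenseInducing_toCompl (PreFock X E)) this

lemma continuous_inner {α : Type*} [TopologicalSpace α] {f g : α → Fock X E}
    (hf : Continuous f) (hg : Continuous g) : Continuous fun a => inner C(X, ℂ) (f a) (g a) :=
  (continuous_inner' (X := X) (E := E)).comp (hf.prodMk hg)

lemma norm_eq (a : Fock X E) : ‖a‖ = √‖inner C(X, ℂ) a a‖ := by
  induction a using Completion.induction_on with
  | hp => exact isClosed_eq continuous_norm (continuous_inner continuous_id continuous_id).norm.sqrt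
  | ih u => rw [Completion.norm_coe, inner_coe, PreFock.norm_def]

lemma inner_smul' (f : C(X, ℂ)) (a b : Fock X E) :
    inner C(X, ℂ) a (f • b) = f * inner C(X, ℂ) a b := by
  have hf : Continuous fun b : Fock X E => f • b := continuous_const_smul f
  have h1 : Continuous fun p : Fock X E × Fock X E => inner C(X, ℂ) p.1 (f • p.2) :=
    continuous_inner continuous_fst (hf.comp continuous_snd)
  have h2 : Continuous fun p : Fock X E × Fock X E => f * inner C(X, ℂ) p.1 p.2 :=
    continuous_const.mul (continuous_inner continuous_fst continuous_snd)
  induction a, b using Completion.induction_on₂ with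
  | hp => exact isClosed_eq h1 h2
  | ih u v => rw [← Completion.coe_smul, inner_coe, inner_coe, PreFock.inner_smul_right]

/-- The Fock module is a Hilbert `C(X)`-module. -/
instance : CStarModule C(X, ℂ) (Fock X E) where
  inner_add_right {a b c} := by
    induction a, b, c using Completion.induction_on₃ with
    | hp =>
      have h1 : Continuous fun p : Fock X E × Fock X E × Fock X E => p.1 := continuous_fst
      have h2 : Continuous fun p : Fock X E × Fock X E × Fock X E => p.2.1 :=
        continuous_fst.comp continuous_snd
      have h3 : Continuous fun p : Fock X E × Fock X E × Fock X E => p.2.2 :=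
        continuous_snd.comp continuous_snd
      exact isClosed_eq (continuous_inner h1 (h2.add h3))
        ((continuous_inner h1 h2).add (continuous_inner h1 h3))
    | ih u v w => simp only [← Completion.coe_add, inner_coe, PreFock.inner_add_right]
  inner_self_nonneg {a} := by
    induction a using Completion.induction_on with
    | hp => exact isClosed_le continuous_const (continuous_inner continuous_id continuous_id)
    | ih u => rw [inner_coe]; exact PreFock.inner_self_nonneg u
  inner_self {a} := by
    rw [← norm_eq_zero (a := a), norm_eq, Real.sqrt_eq_zero (norm_nonneg _), norm_eq_zero]
  inner_op_smul_right {f a b} := inner_smul' f a b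
  inner_smul_right_complex {c a b} := by
    have h : c • b = (algebraMap ℂ C(X, ℂ) c) • b := (algebraMap_smul _ _ _).symm
    rw [h, inner_smul']
    ext x
    simp
  star_inner a b := by
    induction a, b using Completion.induction_on₂ with
    | hp =>
      exact isClosed_eq (continuous_inner continuous_fst continuous_snd).star
        (continuous_inner continuous_snd continuous_fst)
    | ih u v => simp only [inner_coe, PreFock.inner_star]
  norm_eq_sqrt_norm_inner_self a := norm_eq a

variable (X) in
/-- The elementary tensor `ζ₁ ⊗ ⋯ ⊗ ζₖ` in the Fock module. -/
def tensor (w : List E) : Fock X E := ((PreFock.single X w 1 : PreFock X E) : Fock X E)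

lemma inner_tensor (s t : List E) :
    inner C(X, ℂ) (tensor X s) (tensor X t) = wordInner X E s t := by
  rw [tensor, tensor, inner_coe, PreFock.inner_single_single]
  simp

end Fock

end Fock

section Adjointable

variable (X : Type*) (M : Type*) [TopologicalSpace X] [CompactSpace X]
  [NormedAddCommGroup M] [NormedSpace ℂ M] [Module C(X, ℂ) M] [CStarModule C(X, ℂ) M]

/-- The adjointable operators on a Hilbert `C(X)`-module `M`: the bounded operators `T` with an
adjoint `T*`, i.e. `⟪T a, b⟫ = ⟪a, T* b⟫` for all `a` and `b`. -/
structure Adjointable where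
  /-- The operator. -/
  op : M →L[ℂ] M
  /-- Its adjoint. -/
  adj : M →L[ℂ] M
  inner_left' : ∀ a b : M, inner C(X, ℂ) (op a) b = inner C(X, ℂ) a (adj b)

variable {X M}

lemma eq_of_inner {a b : M} (h : ∀ c : M, inner C(X, ℂ) c a = inner C(X, ℂ) c b) : a = b := by
  rw [← sub_eq_zero, ← CStarModule.inner_self (A := C(X, ℂ)), CStarModule.inner_sub_right, h,
    sub_self]

instance : IsScalarTower ℂ C(X, ℂ) M where
  smul_assoc c f a := eq_of_inner (X := X) fun b => by simp

instance : IsBoundedSMul C(X, ℂ) M :=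
  IsBoundedSMul.of_norm_smul_le fun f a => by
    refine (sq_le_sq₀ (norm_nonneg _) (by positivity)).1 ?_
    rw [CStarModule.norm_sq_eq C(X, ℂ), CStarModule.inner_op_smul_left,
      CStarModule.inner_op_smul_right, mul_assoc, mul_comm, mul_assoc]
    refine (norm_mul_le _ _).trans ?_
    rw [CStarRing.norm_star_mul_self, mul_pow, CStarModule.norm_sq_eq C(X, ℂ) (x := a), mul_comm,
      pow_two]

namespace Adjointable

instance : CoeFun (Adjointable X M) (fun _ => M → M) where
  coe T := T.op

@[ext]
lemma ext {S T : Adjointable X M} (h : ∀ a, S a = T a) : S = T := by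
  have h1 : S.op = T.op := ContinuousLinearMap.ext h
  have h2 : S.adj = T.adj := ContinuousLinearMap.ext fun a => eq_of_inner (X := X) fun b => by
    rw [← S.inner_left', ← T.inner_left', h]
  cases S
  cases T
  simp_all

instance : Zero (Adjointable X M) := ⟨⟨0, 0, fun a b => by simp⟩⟩
instance : One (Adjointable X M) := ⟨⟨1, 1, fun _ _ => rfl⟩⟩
instance : Add (Adjointable X M) :=
  ⟨fun S T => ⟨S.op + T.op, S.adj + T.adj, fun a b => by
    simp [S.inner_left', T.inner_left']⟩⟩
instance : Neg (Adjointable X M) := ⟨fun S => ⟨-S.op, -S.adj, fun a b => by simp [S.inner_left']⟩⟩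
instance : Mul (Adjointable X M) :=
  ⟨fun S T => ⟨S.op * T.op, T.adj * S.adj, fun a b => by simp [S.inner_left', T.inner_left']⟩⟩

/-- The involution `T ↦ T*`. -/
instance : Star (Adjointable X M) where
  star T := ⟨T.adj, T.op, fun a b => by
    rw [← CStarModule.star_inner, ← T.inner_left', CStarModule.star_inner]⟩

@[simp] lemma zero_apply (a : M) : (0 : Adjointable X M) a = 0 := rfl
@[simp] lemma one_apply (a : M) : (1 : Adjointable X M) a = a := rfl
@[simp] lemma add_apply (S T : Adjointable X M) (a : M) : (S + T) a = S a + T a := rfl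
@[simp] lemma neg_apply (S : Adjointable X M) (a : M) : (-S) a = -S a := rfl
@[simp] lemma mul_apply (S T : Adjointable X M) (a : M) : (S * T) a = S (T a) := rfl

instance : Ring (Adjointable X M) where
  add_assoc _ _ _ := ext fun _ => add_assoc _ _ _
  zero_add _ := ext fun _ => zero_add _
  add_zero _ := ext fun _ => add_zero _
  add_comm _ _ := ext fun _ => add_comm _ _
  neg_add_cancel _ := ext fun _ => neg_add_cancel _
  mul_assoc _ _ _ := ext fun _ => rfl
  one_mul _ := ext fun _ => rfl
  mul_one _ := ext fun _ => rfl
  zero_mul _ := ext fun _ => rfl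
  mul_zero T := ext fun _ => map_zero T.op
  left_distrib T _ _ := ext fun _ => map_add T.op _ _
  right_distrib _ _ _ := ext fun _ => rfl
  nsmul := nsmulRec
  zsmul := zsmulRec

instance : StarRing (Adjointable X M) where
  star_involutive _ := rfl
  star_mul _ _ := ext fun _ => rfl
  star_add _ _ := ext fun _ => rfl

lemma inner_left (T : Adjointable X M) (a b : M) :
    inner C(X, ℂ) (T a) b = inner C(X, ℂ) a (star T b) := T.inner_left' a b

/-- The operator and its adjoint. -/
def pair (T : Adjointable X M) : (M →L[ℂ] M) × (M →L[ℂ] M) := (T.op, T.adj)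

/-- The topology of the operator norm (the adjoint has the same operator norm). -/
instance : TopologicalSpace (Adjointable X M) := TopologicalSpace.induced pair inferInstance

lemma isInducing_pair : Topology.IsInducing (pair (X := X) (M := M)) := ⟨rfl⟩

lemma continuous_op : Continuous (op (X := X) (M := M)) :=
  continuous_fst.comp isInducing_pair.continuous

lemma continuous_adj : Continuous (adj (X := X) (M := M)) :=
  continuous_snd.comp isInducing_pair.continuous

lemma continuous_iff {N : Type*} [TopologicalSpace N] {f : N → Adjointable X M} :
    Continuous f ↔ Continuous (fun n => (f n).op) ∧ Continuous (fun n => (f n).adj) :=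
  isInducing_pair.continuous_iff.trans continuous_prodMk

instance : IsTopologicalRing (Adjointable X M) where
  continuous_add := continuous_iff.2
    ⟨(continuous_op.comp continuous_fst).add (continuous_op.comp continuous_snd),
      (continuous_adj.comp continuous_fst).add (continuous_adj.comp continuous_snd)⟩
  continuous_mul := continuous_iff.2
    ⟨(continuous_op.comp continuous_fst).mul (continuous_op.comp continuous_snd),
      (continuous_adj.comp continuous_snd).mul (continuous_adj.comp continuous_fst)⟩
  continuous_neg := continuous_iff.2 ⟨continuous_op.neg, continuous_adj.neg⟩

instance : ContinuousStar (Adjointable X M) where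
  continuous_star := continuous_iff.2 ⟨continuous_adj, continuous_op⟩

variable (M) in
/-- Multiplication by a function. -/
def mulBy (f : C(X, ℂ)) : Adjointable X M where
  op := LinearMap.mkContinuous (f • LinearMap.id (R := ℂ)) ‖f‖ fun a => norm_smul_le f a
  adj := LinearMap.mkContinuous (star f • LinearMap.id (R := ℂ)) ‖star f‖
    fun a => norm_smul_le (star f) a
  inner_left' a b := by simp [mul_comm]

lemma mulBy_apply (f : C(X, ℂ)) (a : M) : mulBy M f a = f • a := rfl

variable (X M) in
/-- Multiplication by functions. -/
def multiplication : C(X, ℂ) →+* Adjointable X M where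
  toFun := mulBy M
  map_one' := ext fun a => one_smul _ a
  map_mul' f g := ext fun a => mul_smul f g a
  map_zero' := ext fun a => zero_smul _ a
  map_add' f g := ext fun a => add_smul f g a

lemma map_smul' (T : Adjointable X M) (f : C(X, ℂ)) (a : M) : T (f • a) = f • T a :=
  eq_of_inner (X := X) fun b => by
    have h (c : M) : inner C(X, ℂ) b (T c) = inner C(X, ℂ) (star T b) c := by
      rw [inner_left, star_star]
    rw [CStarModule.inner_op_smul_right, h, h, CStarModule.inner_op_smul_right]

/-- `𝓛(M)` is a `C(X)`-algebra: functions act by multiplication. -/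
instance : Algebra C(X, ℂ) (Adjointable X M) :=
  (multiplication X M).toAlgebra' fun f T => ext fun a => (map_smul' T f a).symm

lemma norm_adj_apply_le (T : Adjointable X M) {C : ℝ} (hC : 0 ≤ C) (h : ∀ a, ‖T a‖ ≤ C * ‖a‖)
    (a : M) : ‖T.adj a‖ ≤ C * ‖a‖ := by
  have h2 : ‖T.adj a‖ ^ 2 ≤ (C * ‖a‖) * ‖T.adj a‖ := by
    rw [CStarModule.norm_sq_eq C(X, ℂ), ← T.inner_left']
    refine (CStarModule.norm_inner_le M).trans ?_
    calc ‖T (T.adj a)‖ * ‖a‖ ≤ (C * ‖T.adj a‖) * ‖a‖ := by gcongr; exact h _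
      _ = _ := by ring
  rcases (norm_nonneg (T.adj a)).eq_or_lt with h0 | h0
  · rw [← h0]; positivity
  · exact le_of_mul_le_mul_right (by rwa [pow_two] at h2) h0

lemma continuous_of_bound {N : Type*} [SeminormedAddCommGroup N] (c : N →+ Adjointable X M)
    (h : ∀ n a, ‖c n a‖ ≤ ‖n‖ * ‖a‖) : Continuous c := by
  let d : N →+ (M →L[ℂ] M) := AddMonoidHom.mk' (fun n => (c n).op) fun m n => by
    rw [map_add]; rfl
  let e : N →+ (M →L[ℂ] M) := AddMonoidHom.mk' (fun n => (c n).adj) fun m n => by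
    rw [map_add]; rfl
  refine continuous_iff.2 ⟨AddMonoidHomClass.continuous_of_bound d 1 fun n => ?_,
    AddMonoidHomClass.continuous_of_bound e 1 fun n => ?_⟩
  · rw [one_mul]
    exact ContinuousLinearMap.opNorm_le_bound _ (norm_nonneg n) (h n)
  · rw [one_mul]
    exact ContinuousLinearMap.opNorm_le_bound _ (norm_nonneg n)
      (norm_adj_apply_le (c n) (norm_nonneg n) (h n))

lemma smul_apply' (f : C(X, ℂ)) (T : Adjointable X M) (a : M) : (f • T) a = f • T a := rfl

instance : StarModule C(X, ℂ) (Adjointable X M) where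
  star_smul f T := ext fun a => map_smul' (star T) (star f) a

end Adjointable

end Adjointable

section Restriction

set_option linter.unusedSectionVars false

variable {X : Type*} [TopologicalSpace X]
variable (A : Type*) [Ring A] [Algebra C(X, ℂ) A] [TopologicalSpace A] [IsTopologicalRing A]

/-- The closed two-sided ideal `C₀(X ∖ F) A` of a `C(X)`-algebra `A`. -/
def vanishingIdeal (F : Set X) : Ideal A :=
  (Ideal.span {a : A | ∃ f : C(X, ℂ), ∃ b : A, (∀ x ∈ F, f x = 0) ∧ a = f • b}).closure

variable {A} in
lemma smul_mem_vanishingIdeal {F : Set X} {f : C(X, ℂ)} (hf : ∀ x ∈ F, f x = 0) (b : A) :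
    f • b ∈ vanishingIdeal A F :=
  subset_closure (Ideal.subset_span ⟨f, b, hf, rfl⟩)

instance (F : Set X) : (vanishingIdeal A F).IsTwoSided where
  mul_mem_of_left := by
    intro a b ha
    refine map_mem_closure (f := fun c : A => c * b) (by fun_prop) ha fun c hc => ?_
    change c * b ∈ Ideal.span _
    refine Submodule.span_induction (p := fun c _ => c * b ∈ Ideal.span _) ?_ ?_ ?_ ?_ hc
    · rintro _ ⟨f, d, hf, rfl⟩
      exact Ideal.subset_span ⟨f, d * b, hf, by rw [smul_mul_assoc]⟩
    · simp
    · intro c d _ _ hc hd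
      simpa only [add_mul] using Ideal.add_mem _ hc hd
    · intro r c _ hc
      simpa only [smul_eq_mul, mul_assoc] using Ideal.mul_mem_left _ r hc

variable {A} in
lemma star_mem_vanishingIdeal [StarRing A] [StarModule C(X, ℂ) A] [ContinuousStar A]
    {F : Set X} {a : A} (ha : a ∈ vanishingIdeal A F) :
    star a ∈ vanishingIdeal A F := by
  have hcl : IsClosed (vanishingIdeal A F : Set A) := isClosed_closure
  have h := map_mem_closure (f := fun c : A => star c) (t := (vanishingIdeal A F : Set A))
    continuous_star ha fun c hc => ?_
  · rw [hcl.closure_eq] at h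
    exact h
  change star c ∈ vanishingIdeal A F
  refine Submodule.span_induction (p := fun c _ => star c ∈ vanishingIdeal A F) ?_ ?_ ?_ ?_ hc
  · rintro _ ⟨f, d, hf, rfl⟩
    rw [star_smul]
    exact smul_mem_vanishingIdeal (fun x hx => by simp [hf x hx]) _
  · simp
  · intro c d _ _ hc hd
    simpa only [star_add] using Ideal.add_mem _ hc hd
  · intro r c _ hc
    simpa only [smul_eq_mul, star_mul] using Ideal.mul_mem_right _ _ hc

/-- The restriction `A|_F = A / C₀(X ∖ F) A` of a `C(X)`-algebra `A`. -/
def Restriction (F : Set X) : Type _ := A ⧸ vanishingIdeal A F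

namespace Restriction

variable {A}

instance (F : Set X) : Ring (Restriction A F) := Ideal.Quotient.ring (vanishingIdeal A F)

instance [StarRing A] [StarModule C(X, ℂ) A] [ContinuousStar A] (F : Set X) :
    Star (Restriction A F) where
  star := Quotient.map' star fun a b h => by
    rw [Submodule.quotientRel_def] at h ⊢
    rw [← star_sub]
    exact star_mem_vanishingIdeal h

/-- The restriction `a|_F` of `a` in `A`. -/
def mk (F : Set X) : A →+* Restriction A F := Ideal.Quotient.mk (vanishingIdeal A F)

/-- The quotient topology. -/
instance (F : Set X) : TopologicalSpace (Restriction A F) :=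
  TopologicalSpace.coinduced (mk F : A →+* Restriction A F) inferInstance

lemma mk_surjective (F : Set X) : Function.Surjective (mk F : A →+* Restriction A F) :=
  Ideal.Quotient.mk_surjective

lemma mk_eq_zero_iff (F : Set X) (a : A) : mk F a = 0 ↔ a ∈ vanishingIdeal A F :=
  Ideal.Quotient.eq_zero_iff_mem

lemma star_mk [StarRing A] [StarModule C(X, ℂ) A] [ContinuousStar A]
    (F : Set X) (a : A) : star (mk F a) = mk F (star a) := rfl

instance [StarRing A] [StarModule C(X, ℂ) A] [ContinuousStar A] (F : Set X) :
    StarRing (Restriction A F) where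
  star_involutive a := by
    obtain ⟨a, rfl⟩ := mk_surjective F a
    rw [star_mk, star_mk, star_star]
  star_mul a b := by
    obtain ⟨a, rfl⟩ := mk_surjective F a
    obtain ⟨b, rfl⟩ := mk_surjective F b
    rw [← map_mul, star_mk, star_mk, star_mk, star_mul, map_mul]
  star_add a b := by
    obtain ⟨a, rfl⟩ := mk_surjective F a
    obtain ⟨b, rfl⟩ := mk_surjective F b
    rw [← map_add, star_mk, star_mk, star_mk, star_add, map_add]

lemma vanishingIdeal_anti {G F : Set X} (h : G ⊆ F) :
    vanishingIdeal A F ≤ vanishingIdeal A G :=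
  closure_mono (Ideal.span_mono fun _ ⟨f, b, hf, e⟩ => ⟨f, b, fun x hx => hf x (h hx), e⟩)

/-- The restriction map `A|_F → A|_G` for `G ⊆ F`. -/
def map {G F : Set X} (h : G ⊆ F) : Restriction A F →+* Restriction A G :=
  Ideal.Quotient.factor (vanishingIdeal_anti h)

lemma map_mk {G F : Set X} (h : G ⊆ F) (a : A) : map h (mk F a) = mk G a := rfl

end Restriction
end Restriction

section SectionRestriction

variable {X : Type*} (E : Type*) [TopologicalSpace X] [CompactSpace X]
  [NormedAddCommGroup E] [NormedSpace ℂ E] [Module C(X, ℂ) E] [CStarModule C(X, ℂ) E]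

/-- The closed submodule `C₀(X ∖ F) E` of a Hilbert `C(X)`-module `E`. -/
def vanishingSubmodule (F : Set X) : Submodule C(X, ℂ) E :=
  (Submodule.span C(X, ℂ)
    {a : E | ∃ f : C(X, ℂ), ∃ b : E, (∀ x ∈ F, f x = 0) ∧ a = f • b}).topologicalClosure

/-- The restriction `E|_F = E / C₀(X ∖ F) E`, with the quotient norm. -/
abbrev SectionRestriction (F : Set X) : Type _ := E ⧸ vanishingSubmodule E F

/-- The fibre `E_x`. -/
abbrev Fibre (x : X) : Type _ := SectionRestriction E ({x} : Set X)

namespace SectionRestriction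

variable {E}

/-- The restriction `ζ|_F` of `ζ` in `E`. -/
abbrev mk (F : Set X) : E →ₗ[C(X, ℂ)] SectionRestriction E F := (vanishingSubmodule E F).mkQ

lemma vanishingSubmodule_anti {G F : Set X} (h : G ⊆ F) :
    vanishingSubmodule E F ≤ vanishingSubmodule E G :=
  closure_mono (Submodule.span_mono fun _ ⟨f, b, hf, e⟩ => ⟨f, b, fun x hx => hf x (h hx), e⟩)

/-- The restriction map `E|_F → E|_G` for `G ⊆ F`. -/
def map {G F : Set X} (h : G ⊆ F) : SectionRestriction E F →ₗ[C(X, ℂ)] SectionRestriction E G :=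
  Submodule.factor (vanishingSubmodule_anti h)

/-- The value `ξ_x ∈ E_x` at a point `x ∈ F` of a section `ξ ∈ E|_F`. -/
def eval {F : Set X} (ξ : SectionRestriction E F) (x : F) : Fibre E (x : X) :=
  map (Set.singleton_subset_iff.2 x.2) ξ

variable {A : Type*} [Ring A] [Algebra C(X, ℂ) A] [TopologicalSpace A] [IsTopologicalRing A]

lemma map_mem_vanishingIdeal (φ : E →ₗ[C(X, ℂ)] A) (hφ : Continuous φ) {F : Set X} {ζ : E}
    (hζ : ζ ∈ vanishingSubmodule E F) : φ ζ ∈ vanishingIdeal A F := by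
  refine map_mem_closure hφ hζ fun ξ hξ => ?_
  change φ ξ ∈ Ideal.span _
  refine Submodule.span_induction (p := fun ξ _ => φ ξ ∈ Ideal.span _) ?_ ?_ ?_ ?_ hξ
  · rintro _ ⟨f, ξ, hf, rfl⟩
    exact Ideal.subset_span ⟨f, φ ξ, hf, map_smul _ _ _⟩
  · simp
  · intro ξ η _ _ h1 h2
    rw [map_add]
    exact Ideal.add_mem _ h1 h2
  · intro f ξ _ h
    rw [map_smul, Algebra.smul_def]
    exact Ideal.mul_mem_left _ _ h

/-- The restriction `E|_F → A|_F`, `ζ|_F ↦ φ(ζ)|_F`, of a continuous `C(X)`-linear map `φ` from `E`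
to a `C(X)`-algebra `A`. -/
def lift (φ : E →ₗ[C(X, ℂ)] A) (hφ : Continuous φ) (F : Set X) :
    SectionRestriction E F →+ Restriction A F :=
  QuotientAddGroup.map (vanishingSubmodule E F).toAddSubgroup
    (vanishingIdeal A F).toAddSubgroup φ.toAddMonoidHom fun _ h => map_mem_vanishingIdeal φ hφ h

lemma lift_mk (φ : E →ₗ[C(X, ℂ)] A) (hφ : Continuous φ) (F : Set X) (ζ : E) :
    lift φ hφ F (mk F ζ) = Restriction.mk F (φ ζ) := rfl

end SectionRestriction

end SectionRestriction

section Toeplitz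

set_option linter.unusedSectionVars false

variable (X : Type*) (E : Type*) [TopologicalSpace X] [CompactSpace X]
  [NormedAddCommGroup E] [NormedSpace ℂ E] [Module C(X, ℂ) E] [CStarModule C(X, ℂ) E]

open UniformSpace

variable {X E} in
/-- Extension to the Fock module of a pair of mutually adjoint operators on formal combinations of
elementary tensors, the first of which is bounded. -/
def extendAdjointable (S T : PreFock X E →ₗ[ℂ] PreFock X E) (C : ℝ) (hC : 0 ≤ C)
    (hS : ∀ u, ‖S u‖ ≤ C * ‖u‖)
    (hST : ∀ u v, inner C(X, ℂ) (S u) v = inner C(X, ℂ) u (T v)) :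
    Adjointable X (Fock X E) :=
  have hT : ∀ v, ‖T v‖ ≤ C * ‖v‖ := fun v => by
    have h : ‖T v‖ ^ 2 ≤ (C * ‖v‖) * ‖T v‖ := by
      rw [PreFock.norm_sq, ← hST]
      refine (PreFock.norm_inner_le _ _).trans ?_
      calc ‖S (T v)‖ * ‖v‖ ≤ (C * ‖T v‖) * ‖v‖ := by gcongr; exact hS _
        _ = _ := by ring
    rcases (norm_nonneg (T v)).eq_or_lt with h0 | h0
    · rw [← h0]; positivity
    · exact le_of_mul_le_mul_right (by rwa [pow_two] at h) h0
  ⟨(S.mkContinuous C hS).completion, (T.mkContinuous C hT).completion,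
    fun a b => by
      induction a, b using Completion.induction_on₂ with
      | hp =>
        refine isClosed_eq (Fock.continuous_inner ?_ continuous_snd)
          (Fock.continuous_inner continuous_fst ?_)
        · exact (ContinuousLinearMap.continuous _).comp continuous_fst
        · exact (ContinuousLinearMap.continuous _).comp continuous_snd
      | ih u v =>
        simp only [ContinuousLinearMap.completion_apply_coe]
        rw [Fock.inner_coe, Fock.inner_coe]
        exact hST u v⟩

variable {X E} in
lemma extendAdjointable_coe (S T : PreFock X E →ₗ[ℂ] PreFock X E) (C : ℝ) (hC : 0 ≤ C) (hS) (hST)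
    (u : PreFock X E) :
    extendAdjointable S T C hC hS hST (u : Fock X E) = (S u : Fock X E) := by
  simp [extendAdjointable]

variable {X E} in
lemma extendAdjointable_star_coe (S T : PreFock X E →ₗ[ℂ] PreFock X E) (C : ℝ) (hC : 0 ≤ C) (hS)
    (hST) (u : PreFock X E) :
    star (extendAdjointable S T C hC hS hST) (u : Fock X E) = (T u : Fock X E) := by
  change (extendAdjointable S T C hC hS hST).adj (u : Fock X E) = _
  simp [extendAdjointable]

variable {E} in
/-- `ζ₁ ⊗ ⋯ ⊗ ζₖ ↦ ζ ⊗ ζ₁ ⊗ ⋯ ⊗ ζₖ` on formal combinations of elementary tensors. -/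
def preCreation (ζ : E) : PreFock X E →ₗ[ℂ] PreFock X E :=
  Finsupp.lmapDomain C(X, ℂ) ℂ (List.cons ζ)

variable {E} in
/-- `ζ₁ ⊗ ⋯ ⊗ ζₖ ↦ ⟪ζ, ζ₁⟫ ζ₂ ⊗ ⋯ ⊗ ζₖ` on formal combinations of elementary tensors. -/
def preAnnihilation (ζ : E) : PreFock X E →ₗ[ℂ] PreFock X E :=
  (Finsupp.linearCombination C(X, ℂ) fun w : List E =>
    match w with
    | [] => (0 : PreFock X E)
    | ξ :: w => PreFock.single X w (inner C(X, ℂ) ζ ξ)).restrictScalars ℂ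

variable {X E}

lemma preCreation_single (ζ : E) (w : List E) (f : C(X, ℂ)) :
    preCreation X ζ (PreFock.single X w f) = PreFock.single X (ζ :: w) f := by
  simp [preCreation, PreFock.single]

lemma preAnnihilation_single_nil (ζ : E) (f : C(X, ℂ)) :
    preAnnihilation X ζ (PreFock.single X [] f) = 0 := by
  simp [preAnnihilation, PreFock.single]

lemma preAnnihilation_single_cons (ζ ξ : E) (w : List E) (f : C(X, ℂ)) :
    preAnnihilation X ζ (PreFock.single X (ξ :: w) f) =
      PreFock.single X w (f * inner C(X, ℂ) ζ ξ) := by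
  simp [preAnnihilation, PreFock.single]

lemma PreFock.inner_zero_right (u : PreFock X E) : inner C(X, ℂ) u 0 = 0 := by
  have := PreFock.inner_smul_right 0 u 0
  simpa using this

lemma PreFock.inner_zero_left (u : PreFock X E) : inner C(X, ℂ) 0 u = 0 := by
  have := PreFock.inner_smul_left 0 0 u
  simpa using this

/-- Adjointness can be checked on elementary tensors. -/
lemma PreFock.adjoint_of_single (S T : PreFock X E →ₗ[ℂ] PreFock X E)
    (h : ∀ s t f g, inner C(X, ℂ) (S (single X s f)) (single X t g) =
      inner C(X, ℂ) (single X s f) (T (single X t g))) (u v : PreFock X E) :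
    inner C(X, ℂ) (S u) v = inner C(X, ℂ) u (T v) := by
  induction u using Finsupp.induction_linear with
  | zero => rw [map_zero, inner_zero_left, inner_zero_left]
  | add u u' hu hu' => rw [map_add, inner_add_left, inner_add_left, hu, hu']
  | single s f =>
    induction v using Finsupp.induction_linear with
    | zero => rw [map_zero, inner_zero_right, inner_zero_right]
    | add v v' hv hv' => rw [map_add, inner_add_right, inner_add_right, hv, hv']
    | single t g => exact h s t f g

lemma preCreation_adjoint (ζ : E) (u v : PreFock X E) :
    inner C(X, ℂ) (preCreation X ζ u) v = inner C(X, ℂ) u (preAnnihilation X ζ v) := by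
  refine PreFock.adjoint_of_single _ _ (fun s t f g => ?_) u v
  rw [preCreation_single, PreFock.inner_single_single]
  cases t with
  | nil => rw [preAnnihilation_single_nil, PreFock.inner_zero_right]; simp [wordInner]
  | cons ξ t =>
    rw [preAnnihilation_single_cons, PreFock.inner_single_single, wordInner]
    ring

lemma preAnnihilation_preCreation (ζ : E) (u : PreFock X E) :
    preAnnihilation X ζ (preCreation X ζ u) = inner C(X, ℂ) ζ ζ • u := by
  induction u using Finsupp.induction_linear with
  | zero => simp
  | add u u' hu hu' => rw [map_add, map_add, hu, hu', smul_add]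
  | single s f =>
    refine (congrArg _ (preCreation_single ζ s f)).trans ?_
    rw [preAnnihilation_single_cons]
    simp [PreFock.single, mul_comm]

lemma norm_preCreation_le (ζ : E) (u : PreFock X E) : ‖preCreation X ζ u‖ ≤ ‖ζ‖ * ‖u‖ := by
  refine (sq_le_sq₀ (norm_nonneg _) (by positivity)).1 ?_
  rw [PreFock.norm_sq, preCreation_adjoint, preAnnihilation_preCreation,
    PreFock.inner_smul_right, mul_pow, PreFock.norm_sq, CStarModule.norm_sq_eq C(X, ℂ)]
  exact norm_mul_le _ _

variable (X) in
/-- The creation operator `ℓ(ζ)`. -/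
def creation (ζ : E) : Adjointable X (Fock X E) :=
  extendAdjointable (preCreation X ζ) (preAnnihilation X ζ) ‖ζ‖ (norm_nonneg ζ)
    (norm_preCreation_le ζ) (preCreation_adjoint ζ)

/-- `ℓ(ζ) (ζ₁ ⊗ ⋯ ⊗ ζₖ) = ζ ⊗ ζ₁ ⊗ ⋯ ⊗ ζₖ`. -/
lemma creation_tensor (ζ : E) (w : List E) :
    creation X ζ (Fock.tensor X w) = Fock.tensor X (ζ :: w) := by
  rw [creation, Fock.tensor, extendAdjointable_coe, preCreation_single]
  rfl

/-- Adjointable operators are determined by the values of their adjoints on elementary tensors. -/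
lemma Adjointable.ext_star {S T : Adjointable X (Fock X E)}
    (h : ∀ w : List E, star S (Fock.tensor X w) = star T (Fock.tensor X w)) : S = T := by
  rw [← star_star S, ← star_star T]
  refine congrArg star (Adjointable.ext fun a => ?_)
  induction a using Completion.induction_on with
  | hp =>
    exact isClosed_eq (ContinuousLinearMap.continuous _) (ContinuousLinearMap.continuous _)
  | ih u =>
    induction u using Finsupp.induction_linear with
    | zero => rw [Completion.coe_zero, map_zero, map_zero]
    | add u v hu hv => rw [Completion.coe_add, map_add, map_add, hu, hv]
    | single s f =>
      have hs : ((Finsupp.single s f : PreFock X E) : Fock X E) = f • Fock.tensor X s := by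
        rw [Fock.tensor, ← Completion.coe_smul]
        simp [PreFock.single]
      rw [hs, Adjointable.map_smul', Adjointable.map_smul', h]

lemma creation_star_nil (ζ : E) : star (creation X ζ) (Fock.tensor X []) = 0 := by
  rw [creation, Fock.tensor, extendAdjointable_star_coe, preAnnihilation_single_nil]
  rfl

lemma creation_star_cons (ζ ξ : E) (w : List E) :
    star (creation X ζ) (Fock.tensor X (ξ :: w)) = inner C(X, ℂ) ζ ξ • Fock.tensor X w := by
  rw [creation, Fock.tensor, extendAdjointable_star_coe, preAnnihilation_single_cons, Fock.tensor,
    ← Completion.coe_smul]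
  simp [PreFock.single]

lemma creation_add (ζ ξ : E) : creation X (ζ + ξ) = creation X ζ + creation X ξ := by
  refine Adjointable.ext_star fun w => ?_
  rw [star_add]
  change _ = star (creation X ζ) _ + star (creation X ξ) _
  cases w with
  | nil => simp only [creation_star_nil, add_zero]
  | cons a w => simp only [creation_star_cons, CStarModule.inner_add_left, add_smul]

lemma creation_smul (f : C(X, ℂ)) (ζ : E) : creation X (f • ζ) = f • creation X ζ := by
  refine Adjointable.ext_star fun w => ?_
  rw [star_smul, Adjointable.smul_apply']
  cases w with
  | nil => simp only [creation_star_nil, smul_zero]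
  | cons a w =>
    simp only [creation_star_cons, CStarModule.inner_op_smul_left, smul_smul, mul_comm]

lemma norm_creation_apply_le (ζ : E) (a : Fock X E) : ‖creation X ζ a‖ ≤ ‖ζ‖ * ‖a‖ := by
  induction a using Completion.induction_on with
  | hp =>
    have := (ContinuousLinearMap.continuous (creation X ζ).op).norm
    exact isClosed_le this (by fun_prop)
  | ih u =>
    rw [creation, extendAdjointable_coe, Completion.norm_coe, Completion.norm_coe]
    exact norm_preCreation_le ζ u

variable (X E) in
/-- The Pimsner-Toeplitz algebra `𝓣(E)`: the closed unital `C(X)`-subalgebra of `𝓛(𝓕(E))`, stable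
under the involution, generated by the creation operators. -/
def toeplitzAlgebra : StarSubalgebra C(X, ℂ) (Adjointable X (Fock X E)) :=
  (StarAlgebra.adjoin C(X, ℂ) (Set.range (creation X (E := E)))).topologicalClosure

variable (X E) in
/-- The elements of the Pimsner-Toeplitz algebra. -/
abbrev Toeplitz : Type _ := toeplitzAlgebra X E

instance : IsTopologicalRing (Toeplitz X E) where
  continuous_neg := continuous_induced_rng.2 continuous_subtype_val.neg

instance : ContinuousStar (Toeplitz X E) where
  continuous_star := continuous_induced_rng.2 continuous_subtype_val.star

variable (X) in
/-- `ζ ↦ ℓ(ζ)`, as a map into `𝓣(E)`. -/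
def ell : E →ₗ[C(X, ℂ)] Toeplitz X E where
  toFun ζ := ⟨creation X ζ, StarSubalgebra.le_topologicalClosure _
    (StarAlgebra.subset_adjoin _ _ ⟨ζ, rfl⟩)⟩
  map_add' ζ ξ := Subtype.ext (creation_add ζ ξ)
  map_smul' f ζ := Subtype.ext (creation_smul f ζ)

lemma val_ell (ζ : E) : (ell X ζ : Adjointable X (Fock X E)) = creation X ζ := rfl

lemma continuous_ell : Continuous (ell X (E := E)) := by
  refine continuous_induced_rng.2 ?_
  let c : E →+ Adjointable X (Fock X E) := AddMonoidHom.mk' (creation X) creation_add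
  exact Adjointable.continuous_of_bound c norm_creation_apply_le

/-- `ξ ↦ ℓ(ξ)` from `E|_F` to `𝓣(E)|_F`, so that `ℓ(ζ|_F) = ℓ(ζ)|_F`. -/
def ellOn (F : Set X) : SectionRestriction E F →+ Restriction (Toeplitz X E) F :=
  SectionRestriction.lift (ell X) continuous_ell F

lemma ellOn_mk (F : Set X) (ζ : E) :
    ellOn F (SectionRestriction.mk F ζ) = Restriction.mk F (ell X ζ) := rfl

/-- `ζ₁ ⊗ ⋯ ⊗ ζₖ ↦ z ^ k (ζ₁ ⊗ ⋯ ⊗ ζₖ)` on formal combinations of elementary tensors. -/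
def preGauge (z : Circle) : PreFock X E →ₗ[ℂ] PreFock X E :=
  (Finsupp.linearCombination C(X, ℂ) fun w : List E =>
    PreFock.single X w (ContinuousMap.const X ((z : ℂ) ^ w.length))).restrictScalars ℂ

lemma preGauge_single (z : Circle) (w : List E) (f : C(X, ℂ)) :
    preGauge z (PreFock.single X w f) =
      PreFock.single X w (f * ContinuousMap.const X ((z : ℂ) ^ w.length)) := by
  simp [preGauge, PreFock.single]

lemma wordInner_eq_zero {s t : List E} (h : s.length ≠ t.length) : wordInner X E s t = 0 := by
  induction s generalizing t with
  | nil => cases t with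
    | nil => exact absurd rfl h
    | cons b t => rfl
  | cons a s ih => cases t with
    | nil => rfl
    | cons b t => rw [wordInner, ih (by simpa using h), mul_zero]

lemma preGauge_adjoint (z : Circle) (u v : PreFock X E) :
    inner C(X, ℂ) (preGauge z u) v = inner C(X, ℂ) u (preGauge z⁻¹ v) := by
  refine PreFock.adjoint_of_single _ _ (fun s t f g => ?_) u v
  rw [preGauge_single, preGauge_single, PreFock.inner_single_single, PreFock.inner_single_single]
  by_cases h : s.length = t.length
  · ext x
    simp only [ContinuousMap.mul_apply, ContinuousMap.star_apply, ContinuousMap.const_apply,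
      star_mul', star_pow, h, Circle.coe_inv_eq_conj, RCLike.star_def]
    ring
  · rw [wordInner_eq_zero h, mul_zero, mul_zero]

lemma preGauge_inv_preGauge (z : Circle) (u : PreFock X E) : preGauge z⁻¹ (preGauge z u) = u := by
  induction u using Finsupp.induction_linear with
  | zero => simp
  | add u u' hu hu' => rw [map_add, map_add, hu, hu']
  | single s f =>
    refine (congrArg _ (preGauge_single z s f)).trans ?_
    rw [preGauge_single, PreFock.single]
    congr 1
    ext x
    simp [mul_assoc]

lemma norm_preGauge_le (z : Circle) (u : PreFock X E) : ‖preGauge z u‖ ≤ 1 * ‖u‖ := by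
  rw [one_mul]
  refine (sq_le_sq₀ (norm_nonneg _) (norm_nonneg _)).1 ?_
  rw [PreFock.norm_sq, preGauge_adjoint, preGauge_inv_preGauge, PreFock.norm_sq]

variable (X E) in
/-- The unitary of `𝓛(𝓕(E))` which is multiplication by `z ^ k` on `E^{⊗ k}`. -/
def gaugeUnitary (z : Circle) : Adjointable X (Fock X E) :=
  extendAdjointable (preGauge z) (preGauge z⁻¹) 1 zero_le_one (norm_preGauge_le z)
    (preGauge_adjoint z)

lemma gaugeUnitary_tensor (z : Circle) (w : List E) :
    gaugeUnitary X E z (Fock.tensor X w) =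
      ContinuousMap.const X ((z : ℂ) ^ w.length) • Fock.tensor X w := by
  rw [gaugeUnitary, Fock.tensor, extendAdjointable_coe, preGauge_single, ← Completion.coe_smul]
  simp [PreFock.single]

lemma gaugeUnitary_star (z : Circle) : star (gaugeUnitary X E z) = gaugeUnitary X E z⁻¹ := by
  refine Adjointable.ext_star fun w => ?_
  rw [star_star, gaugeUnitary_tensor]
  rw [gaugeUnitary, Fock.tensor, extendAdjointable_star_coe, inv_inv, preGauge_single,
    ← Completion.coe_smul]
  simp [PreFock.single]

lemma gaugeUnitary_star_mul (z : Circle) : star (gaugeUnitary X E z) * gaugeUnitary X E z = 1 := by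
  refine Adjointable.ext_star fun w => ?_
  rw [star_mul, star_star, gaugeUnitary_star]
  change gaugeUnitary X E z⁻¹ (gaugeUnitary X E z _) = Fock.tensor X w
  rw [gaugeUnitary_tensor, Adjointable.map_smul', gaugeUnitary_tensor, smul_smul]
  convert one_smul C(X, ℂ) _ using 2
  ext x
  simp

/-- The action `α` of the circle, `α_z(a) = U_z a U_z*`. -/
def gauge (z : Circle) : Adjointable X (Fock X E) →⋆ₐ[C(X, ℂ)] Adjointable X (Fock X E) where
  toFun a := gaugeUnitary X E z * a * star (gaugeUnitary X E z)
  map_one' := by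
    have := gaugeUnitary_star_mul (X := X) (E := E) z⁻¹
    rw [gaugeUnitary_star, inv_inv] at this
    rw [mul_one, gaugeUnitary_star, this]
  map_mul' a b := by
    have := gaugeUnitary_star_mul (X := X) (E := E) z
    simp only [mul_assoc]
    rw [← mul_assoc (star _) (gaugeUnitary X E z), this, one_mul]
  map_zero' := by rw [mul_zero, zero_mul]
  map_add' a b := by rw [mul_add, add_mul]
  commutes' f := by
    have := gaugeUnitary_star_mul (X := X) (E := E) z⁻¹
    rw [gaugeUnitary_star, inv_inv] at this
    rw [← Algebra.commutes, mul_assoc, gaugeUnitary_star, this, mul_one]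
  map_star' a := by rw [star_mul, star_mul, star_star, mul_assoc]

/-- `α_z(ℓ(ζ)) = ℓ(z ζ)`. -/
lemma gauge_creation (z : Circle) (ζ : E) :
    gauge z (creation X ζ) = creation X ((z : ℂ) • ζ) := by
  refine Adjointable.ext_star fun w => ?_
  change star (gaugeUnitary X E z * creation X ζ * star (gaugeUnitary X E z)) _ = _
  rw [star_mul, star_mul, star_star, gaugeUnitary_star]
  change gaugeUnitary X E z (star (creation X ζ) (gaugeUnitary X E z⁻¹ _)) = _
  rw [gaugeUnitary_tensor, Adjointable.map_smul']
  cases w with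
  | nil => rw [creation_star_nil, creation_star_nil, smul_zero, map_zero]
  | cons ξ w =>
    rw [creation_star_cons, creation_star_cons, Adjointable.map_smul', Adjointable.map_smul',
      gaugeUnitary_tensor, smul_smul, smul_smul]
    congr 1
    ext x
    have hz : (z : ℂ) ≠ 0 := Circle.coe_ne_zero z
    simp only [ContinuousMap.mul_apply, ContinuousMap.const_apply, List.length_cons,
      CStarModule.inner_smul_left_complex, ContinuousMap.smul_apply, smul_eq_mul, RCLike.star_def,
      ← Circle.coe_inv_eq_conj, Circle.coe_inv]
    rw [pow_succ', inv_pow]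
    field_simp

variable (X E) in
/-- The fixed-point algebra `𝓣(E)^α`. -/
def fixedAlgebra : StarSubalgebra C(X, ℂ) (Toeplitz X E) where
  carrier := {a | ∀ z : Circle, gauge z (a : Adjointable X (Fock X E)) = a}
  mul_mem' {a b} ha hb z := (map_mul (gauge z) a.1 b.1).trans (congrArg₂ _ (ha z) (hb z))
  add_mem' {a b} ha hb z := (map_add (gauge z) a.1 b.1).trans (congrArg₂ _ (ha z) (hb z))
  algebraMap_mem' f z := AlgHomClass.commutes (gauge z) f
  star_mem' {a} ha z := (map_star (gauge z) a.1).trans (congrArg star (ha z))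

end Toeplitz

section Statement

/-- A projection `p` is properly infinite if it is nonzero and there are partial isometries `s`, `t`
with initial projection `p` and with mutually orthogonal range projections below `p`. The unital
algebra itself is properly infinite if its unit is. -/
def IsProperlyInfinite {A : Type*} [Ring A] [StarRing A] (p : A) : Prop :=
  IsStarProjection p ∧ p ≠ 0 ∧ ∃ s t : A, star s * s = p ∧ star t * t = p ∧
    p * s = s ∧ p * t = t ∧ star s * t = 0

/-- `w ⊕ 1` is homotopic to `1 ⊕ 1` among the unitaries of `M₂(A)`. -/
def IsKOneTrivial {A : Type*} [Ring A] [StarRing A] [TopologicalSpace A] (w : A) : Prop :=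
  JoinedIn {v : Matrix (Fin 2) (Fin 2) A | v ∈ unitary (Matrix (Fin 2) (Fin 2) A)}
    (Matrix.diagonal ![w, 1]) 1

variable {X E : Type*} [TopologicalSpace X] [CompactSpace X]
  [NormedAddCommGroup E] [NormedSpace ℂ E] [Module C(X, ℂ) E] [CStarModule C(X, ℂ) E]

/-- Closed sets `F k` whose interiors cover `X` and norm one sections `ζ k`, of norm one at every
point of `F k`, such that the `ℓ(ζ k)` and the fixed-point algebra generate `𝓣(E)` and such that
`ℓ(ζ k) ℓ(ζ k)*` and `1 - ℓ(ζ k) ℓ(ζ k)*` restrict to properly infinite projections of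
`𝓣(E)|_{F k}`. -/
structure IsAdaptedCover {m : ℕ} (F : Fin m → Set X) (ζ : Fin m → E) : Prop where
  isClosed : ∀ k, IsClosed (F k)
  cover : ⋃ k, interior (F k) = Set.univ
  norm_eq_one : ∀ k, ‖ζ k‖ = 1
  norm_value_eq_one : ∀ k, ∀ x ∈ F k, ‖(SectionRestriction.mk {x} (ζ k) : Fibre E x)‖ = 1
  generate : (StarAlgebra.adjoin C(X, ℂ)
    ((fixedAlgebra X E : Set (Toeplitz X E)) ∪ Set.range fun k => ell X (ζ k))).topologicalClosure
      = ⊤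
  range_infinite : ∀ k, IsProperlyInfinite
    (Restriction.mk (F k) (ell X (ζ k) * star (ell X (ζ k))))
  compl_infinite : ∀ k, IsProperlyInfinite
    (Restriction.mk (F k) (1 - ell X (ζ k) * star (ell X (ζ k))))

/-- The union `G l` of the sets `F j` with `j ≤ l`. -/
def partialUnion {m : ℕ} (F : Fin m → Set X) (l : ℕ) : Set X := ⋃ j : Fin m, ⋃ _ : j.val ≤ l, F j

/-- The overlap of `G l` with `F (l + 1)`. -/
def overlap {m : ℕ} (F : Fin m → Set X) (l : ℕ) (hl : l + 1 < m) : Set X :=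
  partialUnion F l ∩ F ⟨l + 1, hl⟩

/-- The unitary `w` of `𝓣(E)` restricted to the overlap satisfies `w ℓ(ξ) = ℓ(ζ (l + 1))` there,
and is `K₁`-trivial. -/
structure IsConnecting {m : ℕ} (F : Fin m → Set X) (ζ : Fin m → E) (l : ℕ) (hl : l + 1 < m)
    (ξ : SectionRestriction E (partialUnion F l))
    (w : Restriction (Toeplitz X E) (overlap F l hl)) : Prop where
  unitary : w ∈ unitary (Restriction (Toeplitz X E) (overlap F l hl))
  carry : w * Restriction.map Set.inter_subset_left (ellOn (partialUnion F l) ξ) =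
    Restriction.mk (overlap F l hl) (ell X (ζ ⟨l + 1, hl⟩))
  kOneTrivial : IsKOneTrivial w

/-- `w` is the restriction to the overlap of a unitary of `𝓣(E)^α|_{F (l + 1)}`. -/
def LiftsToFixed {m : ℕ} (F : Fin m → Set X) (l : ℕ) (hl : l + 1 < m)
    (w : Restriction (Toeplitz X E) (overlap F l hl)) : Prop :=
  ∃ z : Restriction (Toeplitz X E) (F ⟨l + 1, hl⟩),
    z ∈ unitary (Restriction (Toeplitz X E) (F ⟨l + 1, hl⟩)) ∧
    (∃ a ∈ fixedAlgebra X E, Restriction.mk (F ⟨l + 1, hl⟩) a = z) ∧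
    Restriction.map Set.inter_subset_right z = w

end Statement

end PimsnerToeplitz

end

open PimsnerToeplitz

/-! Everything rests on `star_ell_mul_ell`: ℓ(ζ)*ℓ(ξ) is the function ⟪ζ, ξ⟫. Over a closed set
where ζ has norm one, ℓ(ζ) is therefore an isometry, and orthogonal sections give isometries with
orthogonal ranges.

(1) is local. Near every point there are two orthogonal sections of norm one, which makes the range
projection and its complement properly infinite, and finitely many such neighbourhoods cover X. As
ℓ(η)ℓ(ζ_k)* is gauge invariant, a partition of unity writes each ℓ(η) = ∑ p_k ℓ(η)ℓ(ζ_k)*ℓ(ζ_k) in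
the required subalgebra.

(2) needs, for ξ of norm one on a closed Y, an isometry over Y with range orthogonal to that of
ℓ(ξ). A single section orthogonal to ξ may have zeros, but finitely many η_0, …, η_{n-1} have no
common zero on Y. The tensors η_k^{⊗(k+1)} ⊗ ξ^{⊗(n-k)} are mutually orthogonal in E^{⊗(n+1)}, so
their sum vanishes nowhere on Y and can be normalised (`exists_orthogonal_isometry`). Such
isometries make the complements of the ranges of ℓ(ξ) and ℓ(ζ) absorb each other, whence a unitary w
with wℓ(ξ) = ℓ(ζ) (`exists_unitary_mul_eq`). Multiplying w on the right by a copy of w* placed on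
the range of the orthogonal isometry keeps this relation and kills the K₁-class
(`isKOneTrivial_corner`).

(3) goes by induction on l. A gauge invariant operator preserves the summand E of degree one
(`exists_oneParticle_eq`). If a lifts the connecting unitary, then a*ζ_{l+1} is a section of E, of
norm one on F_{l+1}, which agrees with ξ on the overlap; `exists_unit_on_union` turns the two into a
unit section on the union. Once ξ is a unit section on all of X, ℓ(ξ) and the isometry orthogonal to
it, now taken with Y = X, show that 𝓣(E) is properly infinite. -/

namespace PimsnerToeplitz

/-! ### Isometries with orthogonal ranges in a *-ring. -/

section Isometries

variable {A : Type*} [Ring A] [StarRing A]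

lemma star_mul_eq_zero {x y : A} (h : star x * y = 0) : star y * x = 0 := by
  have := congrArg star h
  rwa [star_mul, star_star, star_zero] at this

/-- If `v` and `s` are isometries with orthogonal ranges then `1 - v v*` absorbs `1 - u u*` for
every isometry `u`: it is the orthogonal sum of copies of itself and of `1 - u u*`. -/
lemma exists_absorbing {u v s : A} (hu : star u * u = 1) (hv : star v * v = 1)
    (hs : star s * s = 1) (hvs : star v * s = 0) :
    ∃ a b : A, star v * a = 0 ∧ star v * b = 0 ∧ star a * b = 0 ∧ a * v = 0 ∧ b * u = 0 ∧
      star a * a = 1 - v * star v ∧ star b * b = 1 - u * star u ∧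
      v * star v + a * star a + b * star b = 1 := by
  have hsv : star s * v = 0 := star_mul_eq_zero hvs
  have hu' (x : A) : star u * (u * x) = x := by rw [← mul_assoc, hu, one_mul]
  have hv' (x : A) : star v * (v * x) = x := by rw [← mul_assoc, hv, one_mul]
  have hs' (x : A) : star s * (s * x) = x := by rw [← mul_assoc, hs, one_mul]
  have hvs' (x : A) : star v * (s * x) = 0 := by rw [← mul_assoc, hvs, zero_mul]
  have hsv' (x : A) : star s * (v * x) = 0 := by rw [← mul_assoc, hsv, zero_mul]
  -- The range of `s` lies below `1 - v v*`. The first witness compresses `s s*` to `s u u* s*` and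
  -- fixes the rest of `1 - v v*`; this frees `s (1 - u u*) s*`, the range of the second.
  refine ⟨1 - v * star v - s * star s + s * u * star s, s * (1 - u * star u), ?_, ?_, ?_, ?_, ?_,
    ?_, ?_, ?_⟩ <;>
  simp only [star_add, star_sub, star_mul, star_star, star_one, mul_add, add_mul, mul_sub, sub_mul,
    mul_assoc, mul_one, one_mul, mul_zero, hu, hv, hs, hvs, hsv, hu', hv', hs', hvs', hsv'] <;>
  abel

/-- Two isometries, the complements of whose ranges dominate isometries, are unitarily equivalent
from the left. -/
lemma exists_unitary_mul_eq {u v s t : A} (hu : star u * u = 1) (hv : star v * v = 1)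
    (hs : star s * s = 1) (ht : star t * t = 1) (hvs : star v * s = 0) (hut : star u * t = 0) :
    ∃ w ∈ unitary A, w * v = u := by
  obtain ⟨a, b, hva, hvb, hab, hav, hbu, haa, hbb, hp⟩ := exists_absorbing hu hv hs hvs
  obtain ⟨c, d, huc, hud, hcd, hcu, hdv, hcc, hdd, hq⟩ := exists_absorbing hv hu ht hut
  have ra {x y : A} (h : star x * y = 0) (z : A) : star x * (y * z) = 0 := by
    rw [← mul_assoc, h, zero_mul]
  have hvv' (x : A) : star v * (v * x) = x := by rw [← mul_assoc, hv, one_mul]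
  have huu' (x : A) : star u * (u * x) = x := by rw [← mul_assoc, hu, one_mul]
  have haa' (x : A) : star a * (a * x) = (1 - v * star v) * x := by rw [← mul_assoc, haa]
  have hbb' (x : A) : star b * (b * x) = (1 - u * star u) * x := by rw [← mul_assoc, hbb]
  have hcc' (x : A) : star c * (c * x) = (1 - u * star u) * x := by rw [← mul_assoc, hcc]
  have hdd' (x : A) : star d * (d * x) = (1 - v * star v) * x := by rw [← mul_assoc, hdd]
  have rz {x y : A} (h : x * y = 0) (z : A) : x * (y * z) = 0 := by
    rw [← mul_assoc, h, zero_mul]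
  -- Both `1 - v v*` and `1 - u u*` split into a copy of `1 - v v*` (ranges of `a` and `d`) and a
  -- copy of `1 - u u*` (ranges of `b` and `c`); `w` matches the copies and sends `v` to `u`.
  refine ⟨u * star v + d * star a + c * star b, ⟨?_, ?_⟩, ?_⟩
  · rw [← hp]
    simp only [star_add, star_mul, star_star, mul_add, add_mul, mul_sub, sub_mul, mul_assoc,
      one_mul, mul_zero, huu', hcc', hdd', ra huc, ra hud, ra hcd, ra (star_mul_eq_zero huc),
      ra (star_mul_eq_zero hud), ra (star_mul_eq_zero hcd), rz hav, rz hbu]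
    abel
  · rw [← hq]
    simp only [star_add, star_mul, star_star, mul_add, add_mul, mul_sub, sub_mul, mul_assoc,
      one_mul, mul_zero, hvv', haa', hbb', ra hva, ra hvb, ra hab, ra (star_mul_eq_zero hva),
      ra (star_mul_eq_zero hvb), ra (star_mul_eq_zero hab), rz hcu, rz hdv]
    abel
  · simp only [add_mul, mul_assoc, hv, star_mul_eq_zero hva, star_mul_eq_zero hvb, mul_one,
      mul_zero, add_zero]

lemma corner_mem_unitary {s w : A} (hs : star s * s = 1) (hw : w ∈ unitary A) :
    s * w * star s + (1 - s * star s) ∈ unitary A := by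
  have hs' (x : A) : star s * (s * x) = x := by rw [← mul_assoc, hs, one_mul]
  have h1 (x : A) : star w * (w * x) = x := by rw [← mul_assoc, hw.1, one_mul]
  have h2 (x : A) : w * (star w * x) = x := by rw [← mul_assoc, hw.2, one_mul]
  constructor <;>
  simp only [star_add, star_sub, star_mul, star_star, star_one, mul_add, add_mul, mul_sub, sub_mul,
    mul_assoc, mul_one, one_mul, hs', h1, h2] <;>
  abel

end Isometries

/-! ### Rotation homotopies in the 2 × 2 matrices and `K₁`-triviality. -/

section Rotation

variable {A : Type*} [Ring A] [StarRing A] [Algebra ℝ A] [StarModule ℝ A]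

/-- The rotation by the angle `θ` between `s s* ⊕ 0` and `0 ⊕ 1`, for an isometry `s`. -/
noncomputable def cornerRotation (s : A) (θ : ℝ) : Matrix (Fin 2) (Fin 2) A :=
  !![1 - s * star s + Real.cos θ • (s * star s), -(Real.sin θ • s);
    Real.sin θ • star s, Real.cos θ • 1]

lemma cornerRotation_mem_unitary {s : A} (hs : star s * s = 1) (θ : ℝ) :
    cornerRotation s θ ∈ unitary (Matrix (Fin 2) (Fin 2) A) := by
  have hs' (x : A) : star s * (s * x) = x := by rw [← mul_assoc, hs, one_mul]
  have hθ : Real.cos θ * Real.cos θ = 1 - Real.sin θ * Real.sin θ := by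
    have := Real.cos_sq_add_sin_sq θ
    nlinarith
  constructor <;>
  · ext i j
    fin_cases i <;> fin_cases j <;>
    simp [cornerRotation, Matrix.mul_apply, Fin.sum_univ_two, Matrix.star_eq_conjTranspose,
      mul_add, add_mul, mul_sub, sub_mul, mul_assoc, hs, hs', smul_smul, hθ, sub_smul, mul_comm]

variable [TopologicalSpace A] [IsTopologicalRing A] [ContinuousSMul ℝ A]

omit [StarModule ℝ A] in
lemma continuous_cornerRotation (s : A) : Continuous (cornerRotation s) := by
  refine continuous_matrix fun i j => ?_
  fin_cases i <;> fin_cases j <;> simp [cornerRotation] <;> fun_prop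

variable [ContinuousStar A]

/-- Conjugating `1 ⊕ w` by the rotation of angle `π / 2` moves `w` from the second coordinate to the
range of `s` in the first; the smaller angles give the path. -/
lemma joinedIn_corner {s w x : A} (hs : star s * s = 1) (hw : w ∈ unitary A) (hx : x ∈ unitary A) :
    JoinedIn {v : Matrix (Fin 2) (Fin 2) A | v ∈ unitary (Matrix (Fin 2) (Fin 2) A)}
      (Matrix.diagonal ![x * (s * w * star s + (1 - s * star s)), 1])
      (Matrix.diagonal ![x, w]) := by
  have hD {y z : A} (hy : y ∈ unitary A) (hz : z ∈ unitary A) :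
      Matrix.diagonal ![y, z] ∈ unitary (Matrix (Fin 2) (Fin 2) A) := by
    constructor <;>
    · ext i j
      fin_cases i <;> fin_cases j <;>
      simp [Matrix.star_eq_conjTranspose, Matrix.mul_apply, Fin.sum_univ_two, hy.1, hy.2, hz.1, hz.2]
  refine (JoinedIn.ofLine (f := fun r : ℝ => Matrix.diagonal ![x, 1] *
    (cornerRotation s (r * (Real.pi / 2)) * Matrix.diagonal ![1, w] *
      star (cornerRotation s (r * (Real.pi / 2))))) ?_ ?_ ?_ ?_).symm
  · have := (continuous_cornerRotation s).comp
      (continuous_id.mul continuous_const : Continuous fun r : ℝ => r * (Real.pi / 2))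
    exact (continuous_const.mul ((this.mul continuous_const).mul this.star)).continuousOn
  · have : cornerRotation s 0 = 1 := by
      ext i j
      fin_cases i <;> fin_cases j <;> simp [cornerRotation]
    simp [this]
  · have hd (y z : A) : Matrix.diagonal ![y, z] = !![y, 0; 0, z] := by
      ext i j
      fin_cases i <;> fin_cases j <;> rfl
    have hR : cornerRotation s (1 * (Real.pi / 2)) = !![1 - s * star s, -s; star s, 0] := by
      ext i j
      fin_cases i <;> fin_cases j <;> simp [cornerRotation]
    have hR' : star !![1 - s * star s, -s; star s, 0] = !![1 - s * star s, s; -star s, 0] := by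
      ext i j
      fin_cases i <;> fin_cases j <;> simp
    have hs' (y : A) : star s * (s * y) = y := by rw [← mul_assoc, hs, one_mul]
    simp only [hR, hR', hd, Matrix.mul_fin_two]
    congr 1
    simp [mul_add, mul_sub, sub_mul, mul_assoc, hs, hs', add_comm]
  · rintro _ ⟨r, -, rfl⟩
    have h := cornerRotation_mem_unitary hs (r * (Real.pi / 2))
    exact mul_mem (hD hx (one_mem _)) (mul_mem (mul_mem h (hD (one_mem _) hw)) (Unitary.star_mem h))

/-- By `joinedIn_corner`, placing `w*` on the range of `s` or on the whole algebra (the case `s =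
1`) leads to the same `w* ⊕ w`, and in the second case the product is `1`. The lemma is applied with
`w` and `w*` exchanged, so that `w*` is the unitary `x` there... the other way round, `x` is `w*`
only up to the form in which the terms appear. -/
lemma isKOneTrivial_corner {s w : A} (hs : star s * s = 1) (hw : w ∈ unitary A) :
    IsKOneTrivial (w * (s * star w * star s + (1 - s * star s))) := by
  have h1 := joinedIn_corner hs (Unitary.star_mem hw) hw
  have h2 := joinedIn_corner (s := (1 : A)) (by simp) (Unitary.star_mem hw) hw
  refine h1.trans (h2.symm.trans ?_)
  have : (Matrix.diagonal ![w * (1 * star w * star (1 : A) + (1 - 1 * star 1)), 1]) =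
      (1 : Matrix (Fin 2) (Fin 2) A) := by
    rw [← Matrix.diagonal_one]
    congr 1
    ext i
    fin_cases i <;> simp [hw.2]
  rw [this]
  exact JoinedIn.refl (one_mem (unitary _))

end Rotation

/-! ### Pointwise norms of sections, fibres and orthogonal sections. -/

section HilbertModule

variable {X : Type*} [TopologicalSpace X] [CompactSpace X]

/-- A real function as a complex one. -/
def ofRealFun (g : C(X, ℝ)) : C(X, ℂ) := ⟨fun x => (g x : ℂ), by fun_prop⟩

omit [CompactSpace X] in
@[simp] lemma ofRealFun_apply (g : C(X, ℝ)) (x : X) : ofRealFun g x = (g x : ℂ) := rfl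

variable {E : Type*} [NormedAddCommGroup E] [NormedSpace ℂ E] [Module C(X, ℂ) E]
  [CStarModule C(X, ℂ) E]

/-- The function `x ↦ ‖ζ_x‖²`. -/
noncomputable def sqNorm (ζ : E) : C(X, ℝ) :=
  ⟨fun x => (inner C(X, ℂ) ζ ζ x).re, by fun_prop⟩

lemma sqNorm_nonneg (ζ : E) (x : X) : 0 ≤ sqNorm ζ x :=
  (Complex.le_def.1 (CStarModule.inner_self_nonneg (A := C(X, ℂ)) (x := ζ) x)).1

lemma inner_self_apply (ζ : E) (x : X) : inner C(X, ℂ) ζ ζ x = (sqNorm ζ x : ℂ) :=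
  Complex.ext rfl
    (Complex.le_def.1 (CStarModule.inner_self_nonneg (A := C(X, ℂ)) (x := ζ) x)).2.symm

lemma sqNorm_smul (f : C(X, ℂ)) (ζ : E) (x : X) : sqNorm (f • ζ) x = ‖f x‖ ^ 2 * sqNorm ζ x := by
  apply Complex.ofReal_injective
  rw [← inner_self_apply, CStarModule.inner_op_smul_left, CStarModule.inner_op_smul_right]
  simp only [ContinuousMap.mul_apply, inner_self_apply, ContinuousMap.star_apply, RCLike.star_def]
  push_cast
  rw [← Complex.mul_conj']
  ring

lemma norm_sq_eq_norm_sqNorm (ζ : E) : ‖ζ‖ ^ 2 = ‖(sqNorm ζ : C(X, ℝ))‖ := by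
  rw [CStarModule.norm_sq_eq C(X, ℂ)]
  simp only [ContinuousMap.norm_eq_iSup_norm, inner_self_apply, Complex.norm_real]

lemma sqNorm_le (ζ : E) (x : X) : sqNorm ζ x ≤ ‖ζ‖ ^ 2 := by
  rw [norm_sq_eq_norm_sqNorm (X := X)]
  exact (le_abs_self _).trans (ContinuousMap.norm_coe_le_norm (sqNorm ζ) x)

lemma norm_sq_le {ζ : E} {C : ℝ} (hC : 0 ≤ C) (h : ∀ x : X, sqNorm ζ x ≤ C) : ‖ζ‖ ^ 2 ≤ C := by
  rw [norm_sq_eq_norm_sqNorm (X := X)]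
  refine (ContinuousMap.norm_le _ hC).2 fun x => ?_
  rw [Real.norm_of_nonneg (sqNorm_nonneg ζ x)]
  exact h x

/-- Inner products descend to the restrictions of `E`: the vanishing at `x` holds for the generators
`f • d` and survives sums, multiples and limits. -/
lemma inner_apply_eq_zero {F : Set X} {a : E} (ha : a ∈ vanishingSubmodule E F) (b : E) {x : X}
    (hx : x ∈ F) : inner C(X, ℂ) b a x = 0 := by
  have hc : IsClosed {a : E | inner C(X, ℂ) b a x = 0} := by
    refine isClosed_eq ?_ continuous_const
    have h1 : Continuous fun a : E => inner C(X, ℂ) b a :=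
      CStarModule.continuous_inner.comp (continuous_const.prodMk continuous_id)
    exact (continuous_eval_const x).comp h1
  refine closure_minimal (fun c hc => ?_) hc ha
  change inner C(X, ℂ) b c x = 0
  refine Submodule.span_induction (p := fun c _ => inner C(X, ℂ) b c x = 0) ?_ ?_ ?_ ?_ hc
  · rintro _ ⟨f, d, hf, rfl⟩
    simp [hf x hx]
  · simp
  · intro c d _ _ hc hd
    simp [hc, hd]
  · intro f c _ hc
    simp [hc]

lemma sqNorm_eq_of_sub_mem {F : Set X} {a b : E} (h : a - b ∈ vanishingSubmodule E F) {x : X}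
    (hx : x ∈ F) : sqNorm a x = sqNorm b x := by
  have h1 := inner_apply_eq_zero h a hx
  have h2 := inner_apply_eq_zero h b hx
  rw [CStarModule.inner_sub_right] at h1 h2
  have h3 : inner C(X, ℂ) a b x = star (inner C(X, ℂ) b a x) := by
    rw [← CStarModule.star_inner (A := C(X, ℂ)) b a]; rfl
  simp only [ContinuousMap.sub_apply, inner_self_apply, sub_eq_zero] at h1 h2
  apply Complex.ofReal_injective
  rw [h1, h3, h2]
  simp

lemma smul_mem_vanishingSubmodule {F : Set X} {f : C(X, ℂ)} (hf : ∀ x ∈ F, f x = 0) (b : E) :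
    f • b ∈ vanishingSubmodule E F :=
  subset_closure (Submodule.subset_span ⟨f, b, hf, rfl⟩)

open SectionRestriction in
-- The quotient norm on the fibre is the pointwise norm. All representatives have the same pointwise
-- norm at `x`, which bounds their norms from below; cutting off around `x` gives representatives
-- whose norm is as close to it as desired.
lemma norm_mk_sq [T2Space X] (ζ : E) (x : X) : ‖(mk {x} ζ : Fibre E x)‖ ^ 2 = sqNorm ζ x := by
  refine le_antisymm ?_ ?_
  · refine le_of_forall_pos_le_add fun ε hε => ?_
    -- The cut-off is `0` where the pointwise norm squared exceeds its value at `x` by `ε` or more,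
    -- and `1` at `x`, so the class in the fibre is unchanged.
    obtain ⟨g, hg1, hg0, hg⟩ := exists_continuous_zero_one_of_isClosed
      (s := {y | sqNorm ζ x + ε ≤ sqNorm ζ y}) (t := {x})
      (isClosed_le continuous_const (sqNorm ζ).continuous) isClosed_singleton
      (Set.disjoint_singleton_right.2 (by simp [hε]))
    have hm : (mk {x} ζ : Fibre E x) = mk {x} (ofRealFun g • ζ) := by
      refine (Submodule.Quotient.eq _).2 ?_
      have : ζ - ofRealFun g • ζ = (1 - ofRealFun g) • ζ := by rw [sub_smul, one_smul]
      rw [this]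
      refine smul_mem_vanishingSubmodule (fun y hy => ?_) _
      have := hg0 hy
      simp_all
    rw [hm]
    have h1 : ‖(mk {x} (ofRealFun g • ζ) : Fibre E x)‖ ≤ ‖ofRealFun g • ζ‖ :=
      Submodule.Quotient.norm_mk_le _ _
    have h2 : ‖ofRealFun g • ζ‖ ^ 2 ≤ sqNorm ζ x + ε := by
      refine norm_sq_le (X := X) (by have := sqNorm_nonneg ζ x; positivity) fun y => ?_
      rw [sqNorm_smul, ofRealFun_apply, Complex.norm_real]
      have h0 := sqNorm_nonneg ζ y
      have h0' := sqNorm_nonneg ζ x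
      by_cases hy : sqNorm ζ x + ε ≤ sqNorm ζ y
      · rw [hg1 hy]
        simp only [Pi.zero_apply, norm_zero]
        nlinarith
      · obtain ⟨h3, h4⟩ := hg y
        rw [Real.norm_of_nonneg h3]
        have : g y ^ 2 ≤ 1 := pow_le_one₀ h3 h4
        nlinarith
    exact (pow_le_pow_left₀ (norm_nonneg _) h1 2).trans h2
  · refine (Real.sqrt_le_left (norm_nonneg _)).1 ?_
    refine QuotientAddGroup.le_norm_iff.2 fun η hη => ?_
    have h : η - ζ ∈ vanishingSubmodule E {x} := (Submodule.Quotient.eq _).1 hη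
    rw [← sqNorm_eq_of_sub_mem h (Set.mem_singleton x)]
    exact Real.sqrt_le_iff.2 ⟨norm_nonneg _, sqNorm_le η x⟩

open SectionRestriction in
lemma norm_mk_eq_one_iff [T2Space X] (ζ : E) (x : X) :
    ‖(mk {x} ζ : Fibre E x)‖ = 1 ↔ sqNorm ζ x = 1 := by
  rw [← norm_mk_sq, pow_eq_one_iff_of_nonneg (norm_nonneg _) two_ne_zero]

/-- Take `g = 1 / √(max h δ)`, with `δ > 0` a lower bound of `h` on the compact set `Y`: the maximum
is `h` on `Y` and keeps `g` continuous off `Y`. -/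
lemma exists_normalizer {h : C(X, ℝ)} {Y : Set X} (hY : IsClosed Y) (hpos : ∀ x ∈ Y, 0 < h x) :
    ∃ g : C(X, ℝ), (∀ x ∈ Y, g x ^ 2 * h x = 1) ∧ ∀ x, g x ^ 2 * h x ≤ 1 := by
  obtain ⟨δ, hδ, hle⟩ := hY.isCompact.exists_forall_le' h.continuous.continuousOn hpos
  have hm (x : X) : 0 < max (h x) δ := lt_max_of_lt_right hδ
  refine ⟨⟨fun x => (√(max (h x) δ))⁻¹, ?_⟩, fun x hx => ?_, fun x => ?_⟩
  · exact Continuous.inv₀ (by fun_prop) fun x => (Real.sqrt_pos.2 (hm x)).ne'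
  · change (√(max (h x) δ))⁻¹ ^ 2 * h x = 1
    rw [inv_pow, Real.sq_sqrt (hm x).le, max_eq_left (hle x hx), inv_mul_cancel₀ (hpos x hx).ne']
  · change (√(max (h x) δ))⁻¹ ^ 2 * h x ≤ 1
    rw [inv_pow, Real.sq_sqrt (hm x).le, inv_mul_le_one₀ (hm x)]
    exact le_max_left _ _

lemma exists_smul_unit {ζ : E} {Y : Set X} (hY : IsClosed Y) (hpos : ∀ x ∈ Y, 0 < sqNorm ζ x) :
    ∃ f : C(X, ℂ), (∀ x ∈ Y, sqNorm (f • ζ) x = 1) ∧ ∀ x : X, sqNorm (f • ζ) x ≤ 1 := by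
  obtain ⟨g, hg, hg1⟩ := exists_normalizer hY hpos
  have h (x : X) : sqNorm (ofRealFun g • ζ) x = g x ^ 2 * sqNorm ζ x := by
    rw [sqNorm_smul, ofRealFun_apply, Complex.norm_real, Real.norm_eq_abs, sq_abs]
  exact ⟨ofRealFun g, fun x hx => (h x).trans (hg x hx), fun x => (h x).trans_le (hg1 x)⟩

open SectionRestriction in
lemma mk_smul (f : C(X, ℂ)) (ζ : E) (x : X) :
    (mk {x} (f • ζ) : Fibre E x) = f x • (mk {x} ζ : Fibre E x) := by
  refine (Submodule.Quotient.eq _).2 ?_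
  have : f • ζ - f x • ζ = (f - ContinuousMap.const X (f x)) • ζ := by
    have h : ContinuousMap.const X (f x) = f x • (1 : C(X, ℂ)) := by ext; simp
    rw [sub_smul, h, smul_assoc, one_smul]
  rw [this]
  exact smul_mem_vanishingSubmodule (fun y hy => by rw [Set.mem_singleton_iff.1 hy]; simp) _

open SectionRestriction in
lemma exists_sqNorm_pos [T2Space X] {x : X} (hx : ¬ FiniteDimensional ℂ (Fibre E x)) :
    ∃ ζ : E, 0 < sqNorm ζ x := by
  by_contra! h
  refine hx ?_
  have : Subsingleton (Fibre E x) := by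
    refine subsingleton_of_forall_eq 0 fun a => ?_
    obtain ⟨ζ, rfl⟩ := (vanishingSubmodule E {x}).mkQ_surjective a
    have h1 := norm_mk_sq ζ x
    have h2 := le_antisymm (h ζ) (sqNorm_nonneg ζ x)
    rw [h2, sq_eq_zero_iff] at h1
    refine (Submodule.Quotient.mk_eq_zero _).2 ?_
    exact (QuotientAddGroup.norm_mk_eq_zero (S := (vanishingSubmodule E {x}).toAddSubgroup)
      (hS := isClosed_closure)).1 h1
  infer_instance

open SectionRestriction in
-- The section `⟪ξ, ξ⟫ η - ⟪ξ, η⟫ ξ` is orthogonal to `ξ` over all of `X`, without any division. If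
-- all of these vanished at `x`, the value of `ξ` would span the fibre.
lemma exists_orthogonal [T2Space X] {x : X} (hx : ¬ FiniteDimensional ℂ (Fibre E x)) {ξ : E}
    (hξ : 0 < sqNorm ξ x) : ∃ η : E, inner C(X, ℂ) ξ η = 0 ∧ 0 < sqNorm η x := by
  by_contra! h
  refine hx ?_
  have hs : Submodule.span ℂ {(mk {x} ξ : Fibre E x)} = ⊤ := by
    refine eq_top_iff.2 fun a _ => ?_
    obtain ⟨η, rfl⟩ := (vanishingSubmodule E {x}).mkQ_surjective a
    have h0 := h (inner C(X, ℂ) ξ ξ • η - inner C(X, ℂ) ξ η • ξ) (by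
      rw [CStarModule.inner_sub_right, CStarModule.inner_op_smul_right,
        CStarModule.inner_op_smul_right, mul_comm, sub_self])
    have h1 := norm_mk_sq (inner C(X, ℂ) ξ ξ • η - inner C(X, ℂ) ξ η • ξ) x
    rw [le_antisymm h0 (sqNorm_nonneg _ x), sq_eq_zero_iff] at h1
    have h2 : (mk {x} (inner C(X, ℂ) ξ ξ • η - inner C(X, ℂ) ξ η • ξ) : Fibre E x) = 0 := by
      refine (Submodule.Quotient.mk_eq_zero _).2 ?_
      exact (QuotientAddGroup.norm_mk_eq_zero (S := (vanishingSubmodule E {x}).toAddSubgroup)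
        (hS := isClosed_closure)).1 h1
    rw [map_sub, mk_smul, mk_smul, sub_eq_zero, inner_self_apply] at h2
    have hne : (sqNorm ξ x : ℂ) ≠ 0 := by exact_mod_cast hξ.ne'
    refine Submodule.mem_span_singleton.2 ⟨(sqNorm ξ x : ℂ)⁻¹ * inner C(X, ℂ) ξ η x, ?_⟩
    rw [mul_smul, ← h2, smul_smul, inv_mul_cancel₀ hne, one_smul]
  exact ⟨⟨{mk {x} ξ}, by simpa using hs⟩⟩

end HilbertModule

/-! ### Relations between creation operators, and isometries orthogonal to a given one. -/

section ToeplitzRelations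

open UniformSpace

variable {X : Type*} [TopologicalSpace X] [CompactSpace X] {E : Type*} [NormedAddCommGroup E]
  [NormedSpace ℂ E] [Module C(X, ℂ) E] [CStarModule C(X, ℂ) E]

lemma star_ell_mul_ell (ζ ξ : E) :
    star (ell X ζ) * ell X ξ = algebraMap C(X, ℂ) (Toeplitz X E) (inner C(X, ℂ) ζ ξ) := by
  refine Subtype.ext ?_
  change star (creation X ζ) * creation X ξ =
    algebraMap C(X, ℂ) (Adjointable X (Fock X E)) (inner C(X, ℂ) ζ ξ)
  rw [← star_inj]
  refine Adjointable.ext_star fun w => ?_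
  rw [star_star, star_star, Algebra.algebraMap_eq_smul_one, Adjointable.smul_apply',
    Adjointable.one_apply, Adjointable.mul_apply, creation_tensor, creation_star_cons]

/-- Converts an identity in `𝓣(E)|_F` into pointwise identities for vectors of the Fock module. -/
lemma inner_apply_eq_zero_of_mem_vanishingIdeal {F : Set X} {a : Toeplitz X E}
    (ha : a ∈ vanishingIdeal (Toeplitz X E) F) (b c : Fock X E) {x : X} (hx : x ∈ F) :
    inner C(X, ℂ) b (a.1 c) x = 0 := by
  have hc : IsClosed {a : Toeplitz X E | inner C(X, ℂ) b (a.1 c) x = 0} := by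
    refine isClosed_eq ?_ continuous_const
    have h1 : Continuous fun a : Toeplitz X E => a.1.op c :=
      (ContinuousLinearMap.apply ℂ (Fock X E) c).continuous.comp
        (Adjointable.continuous_op.comp continuous_subtype_val)
    exact (continuous_eval_const x).comp (Fock.continuous_inner continuous_const h1)
  refine closure_minimal (fun d hd => ?_) hc ha
  change inner C(X, ℂ) b (d.1 c) x = 0
  -- The vector `b` must stay free: left multiplication by `r` is absorbed by replacing `b` with `r*
  -- b`.
  refine Submodule.span_induction (p := fun d _ => ∀ b, inner C(X, ℂ) b (d.1 c) x = 0)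
    ?_ ?_ ?_ ?_ hd b
  · rintro _ ⟨f, d, hf, rfl⟩ b
    change inner C(X, ℂ) b (f • d.1 c) x = 0
    rw [Fock.inner_smul', ContinuousMap.mul_apply, hf x hx, zero_mul]
  · intro b
    exact DFunLike.congr_fun (CStarModule.inner_zero_right (A := C(X, ℂ)) (x := b)) x
  · intro d e _ _ hd he b
    refine (DFunLike.congr_fun (CStarModule.inner_add_right (A := C(X, ℂ)) (x := b)
      (y := d.1 c) (z := e.1 c)) x).trans ?_
    rw [ContinuousMap.add_apply, hd b, he b, add_zero]
  · intro r d _ hd b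
    change inner C(X, ℂ) b (r.1 (d.1 c)) x = 0
    have := Adjointable.inner_left (star r.1) b (d.1 c)
    rw [star_star] at this
    rw [← this]
    exact hd _

lemma nontrivial_restriction {F : Set X} (hF : F.Nonempty) :
    (1 : Restriction (Toeplitz X E) F) ≠ 0 := by
  obtain ⟨x, hx⟩ := hF
  intro h
  have h1 := inner_apply_eq_zero_of_mem_vanishingIdeal
    ((Restriction.mk_eq_zero_iff F (1 : Toeplitz X E)).1 (by rw [map_one, h]))
    (Fock.tensor X []) (Fock.tensor X []) hx
  change inner C(X, ℂ) (Fock.tensor X ([] : List E)) (Fock.tensor X []) x = 0 at h1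
  rw [Fock.inner_tensor] at h1
  simp [wordInner] at h1

lemma restriction_algebraMap_eq {F : Set X} {f g : C(X, ℂ)} (h : ∀ x ∈ F, f x = g x) :
    Restriction.mk F (algebraMap C(X, ℂ) (Toeplitz X E) f) =
      Restriction.mk F (algebraMap C(X, ℂ) (Toeplitz X E) g) := by
  rw [← sub_eq_zero, ← map_sub, ← map_sub, Restriction.mk_eq_zero_iff,
    Algebra.algebraMap_eq_smul_one]
  exact smul_mem_vanishingIdeal (fun x hx => by simp [h x hx]) _

lemma restriction_ell_isometry {F : Set X} {ζ : E} (h : ∀ x ∈ F, sqNorm ζ x = 1) :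
    star (Restriction.mk F (ell X ζ)) * Restriction.mk F (ell X ζ) = 1 := by
  rw [Restriction.star_mk, ← map_mul, star_ell_mul_ell,
    restriction_algebraMap_eq (g := 1) fun x hx => ?_, map_one, map_one]
  rw [inner_self_apply, h x hx]
  simp

lemma star_ell_pow_mul_ell_pow (ζ ξ : E) (k : ℕ) :
    star (ell X ζ ^ k) * ell X ξ ^ k =
      algebraMap C(X, ℂ) (Toeplitz X E) (inner C(X, ℂ) ζ ξ ^ k) := by
  induction k with
  | zero => simp
  | succ k ih =>
    rw [pow_succ, pow_succ, star_mul, mul_assoc, ← mul_assoc (star (ell X ζ ^ k)), ih,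
      Algebra.commutes, ← mul_assoc, star_ell_mul_ell, pow_succ', map_mul]

/-- If the sections `η k` are orthogonal to `ξ` then `S = ∑ ℓ(η k)^(k+1) ℓ(ξ)^(n-k)` has range
orthogonal to the one of `ℓ(ξ)`, and `S* S` is a function: the cross terms vanish. -/
lemma exists_orthogonal_isometry_of_sections {ξ : E} {n : ℕ} {η : Fin n → E}
    (h : ∀ k, inner C(X, ℂ) ξ (η k) = 0) :
    ∃ S : Toeplitz X E, star (ell X ξ) * S = 0 ∧ star S * S =
      algebraMap C(X, ℂ) (Toeplitz X E) (∑ k : Fin n, inner C(X, ℂ) (η k) (η k) ^ (k.val + 1) *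
        inner C(X, ℂ) ξ ξ ^ (n - k)) := by
  have h0 (k : Fin n) : star (ell X ξ) * ell X (η k) = 0 := by
    rw [star_ell_mul_ell, h, map_zero]
  -- For `j < k`, the first `j + 1` letters of the two tensors pair to a function. The next pairing
  -- is of `ξ` with `η k`, hence zero; it occurs because `n - j ≥ 1` and `k ≥ j + 1`.
  have hlt {j k : Fin n} (hjk : j < k) :
      star (ell X (η j) ^ (j.val + 1) * ell X ξ ^ (n - j)) *
        (ell X (η k) ^ (k.val + 1) * ell X ξ ^ (n - k)) = 0 := by
    obtain ⟨m, hm⟩ : ∃ m, k.val + 1 = j.val + 1 + (m + 1) :=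
      ⟨k.val - j.val - 1, by have : j.val < k.val := hjk; omega⟩
    obtain ⟨i, hi⟩ : ∃ i, n - j.val = i + 1 := ⟨n - j.val - 1, by have := j.2; omega⟩
    have e1 : star (ell X (η j) ^ (j.val + 1)) * (ell X (η k) ^ (k.val + 1)) =
        algebraMap C(X, ℂ) (Toeplitz X E) (inner C(X, ℂ) (η j) (η k) ^ (j.val + 1)) *
          ell X (η k) ^ (m + 1) := by
      rw [hm, pow_add _ (j.val + 1), ← mul_assoc, star_ell_pow_mul_ell_pow]
    have e2 : star (ell X ξ ^ (n - j.val)) * ell X (η k) ^ (m + 1) = 0 := by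
      rw [hi, pow_succ' _ i, pow_succ' _ m, star_mul, mul_assoc, ← mul_assoc (star (ell X ξ)), h0,
        zero_mul, mul_zero]
    rw [star_mul, mul_assoc, ← mul_assoc _ _ (ell X ξ ^ (n - k.val)), e1, Algebra.commutes,
      mul_assoc, ← mul_assoc, ← mul_assoc, e2]
    simp
  refine ⟨∑ k : Fin n, ell X (η k) ^ (k.val + 1) * ell X ξ ^ (n - k), ?_, ?_⟩
  · rw [Finset.mul_sum]
    refine Finset.sum_eq_zero fun k _ => ?_
    rw [pow_succ', ← mul_assoc, ← mul_assoc, h0, zero_mul, zero_mul]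
  · rw [star_sum, Finset.sum_mul_sum, map_sum]
    refine Finset.sum_congr rfl fun j _ => ?_
    rw [Finset.sum_eq_single j]
    · rw [star_mul, mul_assoc, ← mul_assoc _ _ (ell X ξ ^ (n - j.val)), star_ell_pow_mul_ell_pow,
        Algebra.commutes, ← mul_assoc, star_ell_pow_mul_ell_pow, ← map_mul, mul_comm]
    · intro k _ hk
      rcases lt_or_gt_of_ne hk with hk | hk
      · exact star_mul_eq_zero (hlt hk)
      · exact hlt hk
    · simp

/-- Near each point of `Y` some section orthogonal to `ξ` is nonzero. Compactness leaves finitely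
many, the sum of their tensor powers has positive pointwise norm on `Y`, and a function normalises
it. -/
lemma exists_orthogonal_isometry [T2Space X] (hE : ∀ x : X, ¬ FiniteDimensional ℂ (Fibre E x))
    {Y : Set X} (hY : IsClosed Y) {ξ : E} (hξ : ∀ x ∈ Y, 0 < sqNorm ξ x) :
    ∃ (S : Toeplitz X E) (f : C(X, ℂ)), star (ell X ξ) * S = 0 ∧
      star S * S = algebraMap C(X, ℂ) (Toeplitz X E) f ∧ ∀ x ∈ Y, f x = 1 := by
  have hloc (x : X) : ∃ η : E, inner C(X, ℂ) ξ η = 0 ∧ (x ∈ Y → 0 < sqNorm η x) := by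
    by_cases hx : x ∈ Y
    · obtain ⟨η, h1, h2⟩ := exists_orthogonal (hE x) (hξ x hx)
      exact ⟨η, h1, fun _ => h2⟩
    -- A default value: points outside `Y` are not used for the cover.
    · exact ⟨0, by simp, fun h => absurd h hx⟩
  choose η hη hpos using hloc
  obtain ⟨t, ht, hcov⟩ := hY.isCompact.elim_nhds_subcover (fun x => {y | 0 < sqNorm (η x) y})
    fun x hx => (isOpen_lt continuous_const (sqNorm (η x)).continuous).mem_nhds (hpos x hx)
  obtain ⟨S, hS, hSS⟩ := exists_orthogonal_isometry_of_sections (ξ := ξ)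
    (η := fun k : Fin t.card => η (t.equivFin.symm k)) fun k => hη _
  let h : C(X, ℝ) := ∑ k : Fin t.card, sqNorm (η (t.equivFin.symm k)) ^ (k.val + 1) *
    sqNorm ξ ^ (t.card - k)
  have hh : ∑ k : Fin t.card, inner C(X, ℂ) (η (t.equivFin.symm k)) (η (t.equivFin.symm k)) ^
      (k.val + 1) * inner C(X, ℂ) ξ ξ ^ (t.card - k) = ofRealFun h := by
    ext x
    simp [h, ContinuousMap.sum_apply, inner_self_apply]
  obtain ⟨g, hg, -⟩ := exists_normalizer (h := h) hY fun x hx => by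
    simp only [h, ContinuousMap.sum_apply, ContinuousMap.mul_apply, ContinuousMap.pow_apply]
    obtain ⟨y, hy, hxy⟩ := Set.mem_iUnion₂.1 (hcov hx)
    refine Finset.sum_pos' (fun k _ => ?_) ⟨t.equivFin ⟨y, hy⟩, Finset.mem_univ _, ?_⟩
    · have := sqNorm_nonneg (η (t.equivFin.symm k)) x
      have := sqNorm_nonneg ξ x
      positivity
    · have := hξ x hx
      have hxy : 0 < sqNorm (η y) x := hxy
      simp only [Equiv.symm_apply_apply]
      positivity
  rw [hh] at hSS
  refine ⟨ofRealFun g • S, ofRealFun g * ofRealFun g * ofRealFun h, ?_, ?_, fun x hx => ?_⟩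
  · rw [mul_smul_comm, hS, smul_zero]
  · rw [star_smul, smul_mul_smul_comm, hSS, map_mul, ← Algebra.smul_def]
    congr 2
    ext x
    simp
  · simp only [ContinuousMap.mul_apply, ofRealFun_apply]
    rw [← sq]
    exact_mod_cast hg x hx

end ToeplitzRelations

/-! ### Topology of the restrictions, and `K₁`-trivial unitaries between unit sections. -/

section RestrictionAlgebra

variable {X : Type*} [TopologicalSpace X]

section General

variable {A : Type*} [Ring A] [Algebra C(X, ℂ) A] [TopologicalSpace A] [IsTopologicalRing A]

lemma Restriction.continuous_mk (F : Set X) :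
    Continuous (Restriction.mk F : A →+* Restriction A F) := continuous_coinduced_rng

/-- Openness matters because products of open quotient maps are quotient maps: continuity of the
ring operations can then be tested before taking quotients. -/
lemma Restriction.isOpenQuotientMap_mk (F : Set X) :
    IsOpenQuotientMap (Restriction.mk F : A →+* Restriction A F) :=
  QuotientAddGroup.isOpenQuotientMap_mk (N := (vanishingIdeal A F).toAddSubgroup)

instance (F : Set X) : IsTopologicalRing (Restriction A F) where
  continuous_add := ((Restriction.isOpenQuotientMap_mk F).prodMap
    (Restriction.isOpenQuotientMap_mk F)).isQuotientMap.continuous_iff.2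
      ((Restriction.continuous_mk F).comp continuous_add)
  continuous_mul := ((Restriction.isOpenQuotientMap_mk F).prodMap
    (Restriction.isOpenQuotientMap_mk F)).isQuotientMap.continuous_iff.2
      ((Restriction.continuous_mk F).comp continuous_mul)
  continuous_neg := (Restriction.isOpenQuotientMap_mk F).isQuotientMap.continuous_iff.2
    ((Restriction.continuous_mk F).comp continuous_neg)

instance [StarRing A] [StarModule C(X, ℂ) A] [ContinuousStar A] (F : Set X) :
    ContinuousStar (Restriction A F) where
  continuous_star := continuous_coinduced_dom.2
    ((Restriction.continuous_mk F).comp continuous_star)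

/-- The real scalars in a `C(X)`-algebra restricted to `F`. -/
noncomputable def realScalars (A : Type*) [Ring A] [Algebra C(X, ℂ) A] [TopologicalSpace A]
    [IsTopologicalRing A] (F : Set X) : ℝ →+* Restriction A F :=
  (Restriction.mk F).comp ((algebraMap C(X, ℂ) A).comp (algebraMap ℝ C(X, ℂ)))

noncomputable instance (F : Set X) : Algebra ℝ (Restriction A F) :=
  (realScalars A F).toAlgebra' fun r a => by
    obtain ⟨a, rfl⟩ := Restriction.mk_surjective F a
    simp only [realScalars, RingHom.comp_apply]
    rw [← map_mul, ← map_mul, Algebra.commutes]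

instance [StarRing A] [StarModule C(X, ℂ) A] [ContinuousStar A] (F : Set X) :
    StarModule ℝ (Restriction A F) where
  star_smul r a := by
    rw [Algebra.smul_def, Algebra.smul_def, star_mul, Algebra.commutes]
    congr 1
    change star (Restriction.mk F (algebraMap C(X, ℂ) A (algebraMap ℝ C(X, ℂ) r))) =
      Restriction.mk F (algebraMap C(X, ℂ) A (algebraMap ℝ C(X, ℂ) (star r)))
    rw [Restriction.star_mk, ← algebraMap_star_comm, ← algebraMap_star_comm]

end General

variable [CompactSpace X] {E : Type*} [NormedAddCommGroup E]
  [NormedSpace ℂ E] [Module C(X, ℂ) E] [CStarModule C(X, ℂ) E]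

lemma continuous_algebraMap_toeplitz : Continuous (algebraMap C(X, ℂ) (Toeplitz X E)) :=
  continuous_induced_rng.2 (Adjointable.continuous_of_bound
    (algebraMap C(X, ℂ) (Adjointable X (Fock X E))).toAddMonoidHom fun f a => norm_smul_le f a)

/-- Needed for the rotation path, whose entries are multiples by `cos θ` and `sin θ`, to be
continuous in the restricted algebra. -/
instance (F : Set X) : ContinuousSMul ℝ (Restriction (Toeplitz X E) F) where
  continuous_smul := by
    have h : Continuous (realScalars (Toeplitz X E) F) :=
      (Restriction.continuous_mk F).comp
        (continuous_algebraMap_toeplitz.comp (continuous_algebraMap ℝ C(X, ℂ)))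
    exact (h.comp continuous_fst).mul continuous_snd

lemma restriction_isometry_of_eq {F : Set X} {S : Toeplitz X E} {f : C(X, ℂ)}
    (hS : star S * S = algebraMap C(X, ℂ) (Toeplitz X E) f) (hf : ∀ x ∈ F, f x = 1) :
    star (Restriction.mk F S) * Restriction.mk F S = 1 := by
  rw [Restriction.star_mk, ← map_mul, hS, restriction_algebraMap_eq (g := 1) hf, map_one, map_one]

/-- Any two sections of norm one on a closed set `Y` are related by a `K₁`-trivial unitary of
`𝓣(E)|_Y`. -/
lemma exists_isKOneTrivial_mul_eq [T2Space X] (hE : ∀ x : X, ¬ FiniteDimensional ℂ (Fibre E x))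
    {Y : Set X} (hY : IsClosed Y) {ξ ζ : E} (hξ : ∀ x ∈ Y, sqNorm ξ x = 1)
    (hζ : ∀ x ∈ Y, sqNorm ζ x = 1) :
    ∃ w ∈ unitary (Restriction (Toeplitz X E) Y),
      w * Restriction.mk Y (ell X ξ) = Restriction.mk Y (ell X ζ) ∧ IsKOneTrivial w := by
  obtain ⟨S, f, hS, hSS, hf⟩ := exists_orthogonal_isometry hE hY (ξ := ξ)
    fun x hx => by rw [hξ x hx]; exact one_pos
  obtain ⟨T, g, hT, hTT, hg⟩ := exists_orthogonal_isometry hE hY (ξ := ζ)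
    fun x hx => by rw [hζ x hx]; exact one_pos
  have hv := restriction_ell_isometry hξ
  have hu := restriction_ell_isometry hζ
  have hs := restriction_isometry_of_eq hSS hf
  have ht := restriction_isometry_of_eq hTT hg
  have hvs : star (Restriction.mk Y (ell X ξ)) * Restriction.mk Y S = 0 := by
    rw [Restriction.star_mk, ← map_mul, hS, map_zero]
  have hut : star (Restriction.mk Y (ell X ζ)) * Restriction.mk Y T = 0 := by
    rw [Restriction.star_mk, ← map_mul, hT, map_zero]
  obtain ⟨w, hw, hwv⟩ := exists_unitary_mul_eq hu hv hs ht hvs hut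
  -- The correcting factor is `w*` on the range of `s` and the identity on its complement. As that
  -- range is orthogonal to the one of `ℓ(ξ)`, the factor fixes `ℓ(ξ)`.
  refine ⟨_, mul_mem hw (corner_mem_unitary hs (Unitary.star_mem hw)), ?_,
    isKOneTrivial_corner hs hw⟩
  rw [mul_assoc, add_mul, sub_mul, mul_assoc, mul_assoc, star_mul_eq_zero hvs, mul_assoc,
    star_mul_eq_zero hvs]
  simp [hwv]

end RestrictionAlgebra

/-! ### Connecting unitaries for an adapted cover. -/

section AdaptedCover

variable {X : Type*} [TopologicalSpace X] [CompactSpace X] {E : Type*} [NormedAddCommGroup E]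
  [NormedSpace ℂ E] [Module C(X, ℂ) E] [CStarModule C(X, ℂ) E]

omit [CompactSpace X] in
lemma isClosed_partialUnion {m : ℕ} {F : Fin m → Set X} (hF : ∀ k, IsClosed (F k)) (l : ℕ) :
    IsClosed (partialUnion F l) :=
  isClosed_iUnion_of_finite fun j => isClosed_iUnion_of_finite fun _ => hF j

lemma IsAdaptedCover.sqNorm_eq_one [T2Space X] {m : ℕ} {F : Fin m → Set X} {ζ : Fin m → E}
    (h : IsAdaptedCover F ζ) (k : Fin m) {x : X} (hx : x ∈ F k) : sqNorm (ζ k) x = 1 :=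
  (norm_mk_eq_one_iff _ _).1 (h.norm_value_eq_one k x hx)

lemma IsAdaptedCover.exists_isConnecting [T2Space X]
    (hE : ∀ x : X, ¬ FiniteDimensional ℂ (Fibre E x)) {m : ℕ} {F : Fin m → Set X} {ζ : Fin m → E}
    (h : IsAdaptedCover F ζ) (l : ℕ) (hl : l + 1 < m) (ξ : SectionRestriction E (partialUnion F l))
    (hξ : ∀ y : partialUnion F l, (y : X) ∈ overlap F l hl → ‖ξ.eval y‖ = 1) :
    ∃ w : Restriction (Toeplitz X E) (overlap F l hl), IsConnecting F ζ l hl ξ w := by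
  obtain ⟨ξ, rfl⟩ := (vanishingSubmodule E (partialUnion F l)).mkQ_surjective ξ
  have hY : IsClosed (overlap F l hl) :=
    (isClosed_partialUnion h.isClosed l).inter (h.isClosed _)
  obtain ⟨w, hw, hc, hk⟩ := exists_isKOneTrivial_mul_eq hE hY (ξ := ξ) (ζ := ζ ⟨l + 1, hl⟩)
    (fun x hx => (norm_mk_eq_one_iff ξ x).1 (hξ ⟨x, hx.1⟩ hx))
    fun x hx => h.sqNorm_eq_one _ hx.2
  exact ⟨w, hw, hc, hk⟩

end AdaptedCover

/-! ### Proper infiniteness from two isometries. -/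

section ProperlyInfinite

variable {A : Type*} [Ring A] [StarRing A]

/-- If the isometries `u`, `v` have orthogonal ranges then `u u*` and `1 - u u*` are properly
infinite. -/
lemma isProperlyInfinite_of_isometries [Nontrivial A] {u v : A} (hu : star u * u = 1)
    (hv : star v * v = 1) (huv : star u * v = 0) :
    IsProperlyInfinite (u * star u) ∧ IsProperlyInfinite (1 - u * star u) := by
  have hu' (x : A) : star u * (u * x) = x := by rw [← mul_assoc, hu, one_mul]
  have hv' (x : A) : star v * (v * x) = x := by rw [← mul_assoc, hv, one_mul]
  have huv' (x : A) : star u * (v * x) = 0 := by rw [← mul_assoc, huv, zero_mul]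
  -- For `u u*`, the isometries `u`, `v` are transported to the corner by `u`. For the complement,
  -- `v` maps everything below `1 - u u*`, so `v u` and `v v`, cut down to it, serve.
  refine ⟨⟨⟨?_, ?_⟩, fun h => ?_, u * u * star u, u * v * star u, ?_, ?_, ?_, ?_, ?_⟩,
    ⟨⟨?_, ?_⟩, fun h => ?_, v * u * (1 - u * star u), v * v * (1 - u * star u), ?_, ?_, ?_, ?_, ?_⟩⟩
  · simp only [IsIdempotentElem, mul_assoc, hu']
  · simp only [IsSelfAdjoint, star_mul, star_star]
  · have h1 : star u * (u * star u) * u = 1 := by simp only [mul_assoc, hu, mul_one]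
    rw [h, mul_zero, zero_mul] at h1
    exact zero_ne_one h1
  iterate 5
    simp only [star_mul, star_star, mul_assoc, hu', hv', huv', mul_zero]
  · simp only [IsIdempotentElem, mul_sub, sub_mul, mul_assoc, hu', mul_one, one_mul]
    abel
  · simp only [IsSelfAdjoint, star_mul, star_star, star_sub, star_one]
  · have h1 : star v * (1 - u * star u) * v = 1 := by
      simp only [mul_sub, sub_mul, mul_assoc, huv, hv, mul_one, mul_zero, sub_zero]
    rw [h, mul_zero, zero_mul] at h1
    exact zero_ne_one h1
  all_goals
    simp only [star_mul, star_sub, star_star, mul_assoc, mul_sub, sub_mul, hu', hv', huv',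
      hu, hv, huv, mul_zero, mul_one, one_mul, sub_zero, sub_self]

end ProperlyInfinite

/-! ### Existence of adapted covers. -/

section Existence

variable {X : Type*} [TopologicalSpace X] [CompactSpace X] {E : Type*} [NormedAddCommGroup E]
  [NormedSpace ℂ E] [Module C(X, ℂ) E] [CStarModule C(X, ℂ) E]

/-- Two orthogonal sections, nonzero at `x`, are normalised where their squared norms are at least
half of those at `x`. Multiplication by functions preserves orthogonality. -/
lemma exists_local_orthonormal [T2Space X] (hE : ∀ x : X, ¬ FiniteDimensional ℂ (Fibre E x))
    (x : X) : ∃ (F : Set X) (ζ η : E), IsClosed F ∧ x ∈ interior F ∧ ‖ζ‖ = 1 ∧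
      (∀ y ∈ F, sqNorm ζ y = 1) ∧ (∀ y ∈ F, sqNorm η y = 1) ∧ inner C(X, ℂ) ζ η = 0 := by
  obtain ⟨a, ha⟩ := exists_sqNorm_pos (hE x)
  obtain ⟨b, hab, hb⟩ := exists_orthogonal (hE x) ha
  let F : Set X := {y | sqNorm a x / 2 ≤ sqNorm a y} ∩ {y | sqNorm b x / 2 ≤ sqNorm b y}
  have hF : IsClosed F := (isClosed_le continuous_const (sqNorm a).continuous).inter
    (isClosed_le continuous_const (sqNorm b).continuous)
  have hxF : x ∈ interior F := by
    refine mem_interior_iff_mem_nhds.2 (Filter.inter_mem ?_ ?_)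
    · exact Filter.mem_of_superset ((isOpen_lt continuous_const
        (sqNorm a).continuous).mem_nhds (half_lt_self ha)) fun y hy =>
          show sqNorm a x / 2 ≤ sqNorm a y from le_of_lt hy
    · exact Filter.mem_of_superset ((isOpen_lt continuous_const
        (sqNorm b).continuous).mem_nhds (half_lt_self hb)) fun y hy =>
          show sqNorm b x / 2 ≤ sqNorm b y from le_of_lt hy
  obtain ⟨f, hf, hf1⟩ := exists_smul_unit hF (ζ := a) fun y hy => (half_pos ha).trans_le hy.1
  obtain ⟨g, hg, -⟩ := exists_smul_unit hF (ζ := b) fun y hy => (half_pos hb).trans_le hy.2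
  refine ⟨F, f • a, g • b, hF, hxF, ?_, hf, hg, ?_⟩
  · have h1 := norm_sq_le zero_le_one hf1
    have h2 := sqNorm_le (f • a) x
    rw [hf x (interior_subset hxF)] at h2
    exact (pow_eq_one_iff_of_nonneg (norm_nonneg _) two_ne_zero).1 (le_antisymm h1 h2)
  · rw [CStarModule.inner_op_smul_left, CStarModule.inner_op_smul_right, hab, mul_zero, zero_mul]

lemma ell_mul_star_ell_mem_fixedAlgebra (ζ ξ : E) :
    ell X ζ * star (ell X ξ) ∈ fixedAlgebra X E := by
  intro z
  change gauge z (creation X ζ * star (creation X ξ)) = creation X ζ * star (creation X ξ)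
  have h1 : creation X ((z : ℂ) • ζ) = ContinuousMap.const X (z : ℂ) • creation X ζ := by
    rw [← creation_smul]
    have h : ContinuousMap.const X (z : ℂ) = (z : ℂ) • (1 : C(X, ℂ)) := by ext; simp
    rw [h, smul_assoc, one_smul]
  have h2 : creation X ((z : ℂ) • ξ) = ContinuousMap.const X (z : ℂ) • creation X ξ := by
    rw [← creation_smul]
    have h : ContinuousMap.const X (z : ℂ) = (z : ℂ) • (1 : C(X, ℂ)) := by ext; simp
    rw [h, smul_assoc, one_smul]
  rw [map_mul, map_star, gauge_creation, gauge_creation, h1, h2, star_smul, smul_mul_smul_comm]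
  convert one_smul C(X, ℂ) _ using 2
  ext x
  simp [Complex.mul_conj]

/-- With `p` a partition of unity, `∑ p_k ⟪ζ_k, ζ_k⟫ = 1`, so `ℓ(η) = ∑ p_k (ℓ(η) ℓ(ζ_k)*) ℓ(ζ_k)`.
The factor in brackets is gauge invariant, as the scalars `z` and `z̄` cancel. -/
lemma topologicalClosure_adjoin_eq_top [T2Space X] {m : ℕ} {F : Fin m → Set X} {ζ : Fin m → E}
    (hcov : ⋃ k, interior (F k) = Set.univ) (hζ : ∀ k, ∀ x ∈ F k, sqNorm (ζ k) x = 1) :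
    (StarAlgebra.adjoin C(X, ℂ) ((fixedAlgebra X E : Set (Toeplitz X E)) ∪
      Set.range fun k => ell X (ζ k))).topologicalClosure = ⊤ := by
  obtain ⟨p, hp⟩ := PartitionOfUnity.exists_isSubordinate_of_locallyFinite isClosed_univ
    (fun k => interior (F k)) (fun _ => isOpen_interior) (locallyFinite_of_finite _) hcov.ge
  set B := StarAlgebra.adjoin C(X, ℂ) ((fixedAlgebra X E : Set (Toeplitz X E)) ∪
    Set.range fun k => ell X (ζ k)) with hB
  have hmem (η : E) : ell X η ∈ B := by
    have h1 : ∑ k, ofRealFun (p k) * inner C(X, ℂ) (ζ k) (ζ k) = (1 : C(X, ℂ)) := by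
      ext x
      have hx := p.sum_eq_one (Set.mem_univ x)
      rw [finsum_eq_sum_of_fintype] at hx
      simp only [ContinuousMap.sum_apply, ContinuousMap.mul_apply, ofRealFun_apply,
        inner_self_apply, ContinuousMap.one_apply]
      rw [← Complex.ofReal_one, ← hx, Complex.ofReal_sum]
      refine Finset.sum_congr rfl fun k _ => ?_
      by_cases hk : x ∈ F k
      · rw [hζ k x hk, Complex.ofReal_one, mul_one]
      · have : p k x = 0 := by
          by_contra h0
          exact hk (interior_subset (hp k (subset_tsupport _ h0)))
        rw [this, Complex.ofReal_zero, zero_mul]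
    have h2 : ell X η = ∑ k, ofRealFun (p k) • (ell X η * star (ell X (ζ k)) * ell X (ζ k)) := by
      have (k : Fin m) : ofRealFun (p k) • (ell X η * star (ell X (ζ k)) * ell X (ζ k)) =
          algebraMap C(X, ℂ) (Toeplitz X E) (ofRealFun (p k) * inner C(X, ℂ) (ζ k) (ζ k)) *
            ell X η := by
        rw [mul_assoc, star_ell_mul_ell, ← Algebra.commutes, Algebra.smul_def, ← mul_assoc,
          ← map_mul]
      simp only [this]
      rw [← Finset.sum_mul, ← map_sum, h1, map_one, one_mul]
    rw [h2]
    refine sum_mem fun k _ => B.smul_mem (mul_mem ?_ ?_) _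
    · exact StarAlgebra.subset_adjoin _ _ (Or.inl (ell_mul_star_ell_mem_fixedAlgebra η (ζ k)))
    · exact StarAlgebra.subset_adjoin _ _ (Or.inr ⟨k, rfl⟩)
  have hle : StarAlgebra.adjoin C(X, ℂ) (Set.range (creation X (E := E))) ≤
      B.map (toeplitzAlgebra X E).subtype := by
    refine StarAlgebra.adjoin_le ?_
    rintro _ ⟨η, rfl⟩
    exact ⟨ell X η, hmem η, rfl⟩
  refine eq_top_iff.2 fun a _ => ?_
  -- The closure inside `𝓣(E)` is compared with the closure in `𝓛(𝓕(E))`, which defines `𝓣(E)`.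
  change a ∈ closure (B : Set (Toeplitz X E))
  rw [closure_subtype]
  exact closure_mono hle a.2

lemma exists_isAdaptedCover [T2Space X] (hE : ∀ x : X, ¬ FiniteDimensional ℂ (Fibre E x)) :
    ∃ (m : ℕ) (F : Fin m → Set X) (ζ : Fin m → E), IsAdaptedCover F ζ := by
  choose F ζ η hF hx hζ hζF hηF hort using exists_local_orthonormal hE
  obtain ⟨t, ht⟩ := isCompact_univ.elim_finite_subcover (fun x => interior (F x))
    (fun _ => isOpen_interior) fun x _ => Set.mem_iUnion.2 ⟨x, hx x⟩
  let e (k : Fin t.card) : X := t.equivFin.symm k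
  have hcov : ⋃ k, interior (F (e k)) = Set.univ := by
    refine Set.eq_univ_of_univ_subset fun y hy => ?_
    obtain ⟨x, hxt, hyx⟩ := Set.mem_iUnion₂.1 (ht hy)
    refine Set.mem_iUnion.2 ⟨t.equivFin ⟨x, hxt⟩, ?_⟩
    simpa [e] using hyx
  have hinf (x : X) : IsProperlyInfinite
        (Restriction.mk (F x) (ell X (ζ x) * star (ell X (ζ x)))) ∧ IsProperlyInfinite
        (Restriction.mk (F x) (1 - ell X (ζ x) * star (ell X (ζ x)))) := by
    have : Nontrivial (Restriction (Toeplitz X E) (F x)) :=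
      ⟨⟨1, 0, nontrivial_restriction ⟨x, interior_subset (hx x)⟩⟩⟩
    rw [map_sub, map_one, map_mul, ← Restriction.star_mk]
    refine isProperlyInfinite_of_isometries (restriction_ell_isometry (hζF x))
      (restriction_ell_isometry (hηF x)) ?_
    rw [Restriction.star_mk, ← map_mul, star_ell_mul_ell, hort, map_zero, map_zero]
  exact ⟨t.card, fun k => F (e k), fun k => ζ (e k), fun k => hF _, hcov, fun k => hζ _,
    fun k x hxk => (norm_mk_eq_one_iff _ _).2 (hζF _ x hxk),
    topologicalClosure_adjoin_eq_top hcov fun k => hζF _, fun k => (hinf _).1, fun k => (hinf _).2⟩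

end Existence

/-! ### Orthogonality and Pythagoras in a Hilbert module. -/

section Orthogonality

variable {X : Type*} [TopologicalSpace X] [CompactSpace X] {E : Type*} [NormedAddCommGroup E]
  [NormedSpace ℂ E] [Module C(X, ℂ) E] [CStarModule C(X, ℂ) E]

lemma inner_smul_smul (f g : C(X, ℂ)) (a b : E) :
    inner C(X, ℂ) (f • a) (g • b) = g * inner C(X, ℂ) a b * star f := by
  rw [CStarModule.inner_op_smul_left, CStarModule.inner_op_smul_right]

lemma inner_sum_smul_eq_zero {ι : Type*} {s : Finset ι} {f : ι → C(X, ℂ)} {v : ι → E} {c : E}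
    (h : ∀ i ∈ s, inner C(X, ℂ) (v i) c = 0) : inner C(X, ℂ) (∑ i ∈ s, f i • v i) c = 0 := by
  rw [CStarModule.inner_sum_left]
  refine Finset.sum_eq_zero fun i hi => ?_
  rw [CStarModule.inner_op_smul_left, h i hi, zero_mul]

lemma norm_le_norm_sub_of_inner_eq_zero {c r : E} (h : inner C(X, ℂ) r c = 0) :
    ‖c‖ ≤ ‖c - r‖ := by
  have h' : inner C(X, ℂ) c r = 0 := by rw [← CStarModule.star_inner, h, star_zero]
  refine (sq_le_sq₀ (norm_nonneg _) (norm_nonneg _)).1 ?_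
  refine norm_sq_le (X := X) (sq_nonneg _) fun x => ?_
  refine le_trans ?_ (sqNorm_le (X := X) _ x)
  have h1 : inner C(X, ℂ) (c - r) (c - r) = inner C(X, ℂ) c c + inner C(X, ℂ) r r := by
    rw [CStarModule.inner_sub_right, CStarModule.inner_sub_left, CStarModule.inner_sub_left, h, h']
    abel
  have h2 := congrArg Complex.re (DFunLike.congr_fun h1 x)
  have h3 := sqNorm_nonneg (X := X) r x
  change sqNorm (c - r) x = sqNorm c x + sqNorm r x at h2
  linarith

end Orthogonality

/-! ### The summand of degree one and its invariance under the fixed-point algebra. -/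

section OneParticle

open UniformSpace

variable {X : Type*} [TopologicalSpace X] [CompactSpace X] {E : Type*} [NormedAddCommGroup E]
  [NormedSpace ℂ E] [Module C(X, ℂ) E] [CStarModule C(X, ℂ) E]

variable (X E) in
/-- The embedding of `E` as the summand of degree one of the Fock module. -/
noncomputable def oneParticle : E →ₗ[C(X, ℂ)] Fock X E where
  toFun ξ := creation X ξ (Fock.tensor X [])
  map_add' ξ η := by rw [creation_add]; rfl
  map_smul' f ξ := by rw [creation_smul]; rfl

lemma oneParticle_eq_tensor (ξ : E) : oneParticle X E ξ = Fock.tensor X [ξ] :=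
  creation_tensor ξ []

lemma inner_oneParticle (ξ η : E) :
    inner C(X, ℂ) (oneParticle X E ξ) (oneParticle X E η) = inner C(X, ℂ) ξ η := by
  rw [oneParticle_eq_tensor, oneParticle_eq_tensor, Fock.inner_tensor, wordInner, wordInner,
    mul_one]

/-- The embedding is isometric and `E` is complete. -/
lemma isClosed_range_oneParticle [CompleteSpace E] :
    IsClosed (LinearMap.range (oneParticle X E) : Set (Fock X E)) := by
  have h : Isometry (oneParticle X E) := AddMonoidHomClass.isometry_of_norm _ fun ξ => by
    rw [Fock.norm_eq, inner_oneParticle, ← CStarModule.norm_eq_sqrt_norm_inner_self]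
  rw [LinearMap.coe_range]
  exact h.isClosedEmbedding.isClosed_range

lemma Fock.coe_eq_sum (u : PreFock X E) :
    (u : Fock X E) = ∑ w ∈ u.support, u w • Fock.tensor X w := by
  have h (w : List E) : ((Finsupp.single w (u w) : PreFock X E) : Fock X E) =
      u w • Fock.tensor X w := by
    rw [Fock.tensor, ← Completion.coe_smul]
    simp [PreFock.single]
  calc (u : Fock X E) = ((∑ w ∈ u.support, Finsupp.single w (u w) : PreFock X E) : Fock X E) :=
        congrArg _ (Finsupp.sum_single u).symm
    _ = ∑ w ∈ u.support, ((Finsupp.single w (u w) : PreFock X E) : Fock X E) :=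
        map_sum (Completion.toCompl (α := PreFock X E)) _ _
    _ = _ := Finset.sum_congr rfl fun w _ => h w

/-- A vector orthogonal to the elementary tensors of degree other than one is of degree one. -/
lemma mem_range_oneParticle [CompleteSpace E] {b : Fock X E}
    (hb : ∀ w : List E, w.length ≠ 1 → inner C(X, ℂ) (Fock.tensor X w) b = 0) :
    b ∈ LinearMap.range (oneParticle X E) := by
  classical
  have horth {c : Fock X E} (hc : ∀ w : List E, w.length ≠ 1 → inner C(X, ℂ) (Fock.tensor X w) c = 0)
      {u : PreFock X E} (hu : ∀ w ∈ u.support, w.length ≠ 1) :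
      inner C(X, ℂ) (u : Fock X E) c = 0 := by
    rw [Fock.coe_eq_sum]
    exact inner_sum_smul_eq_zero fun w hw => hc w (hu w hw)
  rw [← SetLike.mem_coe, ← isClosed_range_oneParticle.closure_eq, Metric.mem_closure_iff]
  intro ε hε
  obtain ⟨u, hu⟩ := Metric.denseRange_iff.1 (Completion.denseRange_coe (α := PreFock X E)) b ε hε
  -- An approximant `u` of `b` splits into its part `u₁` of degree one and the rest `r`. As `r` is
  -- orthogonal to `b - u₁`, Pythagoras shows that `u₁` approximates `b` at least as well as `u`.
  let u₁ : PreFock X E := Finsupp.filter (fun w => w.length = 1) u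
  let r : PreFock X E := Finsupp.filter (fun w => ¬ w.length = 1) u
  have hur : u = u₁ + r := (Finsupp.filter_add_filter_not u _).symm
  obtain ⟨ξ, hξ⟩ : (u₁ : Fock X E) ∈ LinearMap.range (oneParticle X E) := by
    rw [Fock.coe_eq_sum]
    refine sum_mem fun w hw => Submodule.smul_mem _ _ ?_
    rw [Finsupp.support_filter] at hw
    obtain ⟨ξ, rfl⟩ := List.length_eq_one_iff.1 (Finset.mem_filter.1 hw).2
    exact ⟨ξ, oneParticle_eq_tensor ξ⟩
  refine ⟨_, ⟨ξ, rfl⟩, lt_of_le_of_lt ?_ hu⟩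
  have hr : ∀ w ∈ r.support, w.length ≠ 1 := fun w hw => by
    rw [Finsupp.support_filter] at hw
    exact (Finset.mem_filter.1 hw).2
  have h0 : inner C(X, ℂ) (r : Fock X E) (b - oneParticle X E ξ) = 0 := by
    refine (CStarModule.inner_sub_right (A := C(X, ℂ)) (E := Fock X E)).trans (sub_eq_zero.2 ?_)
    refine (horth hb hr).trans (horth (fun w hw => ?_) hr).symm
    rw [oneParticle_eq_tensor, Fock.inner_tensor]
    exact wordInner_eq_zero hw
  have hsub : b - (u : Fock X E) = b - oneParticle X E ξ - (r : Fock X E) := by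
    rw [hξ, sub_sub, ← Completion.coe_add, ← hur]
  rw [dist_eq_norm, dist_eq_norm, hsub]
  exact norm_le_norm_sub_of_inner_eq_zero (X := X) (E := Fock X E) h0

/-- The left side is `z ^ (1 - k)`. It serves to separate degree `k` from degree one by a gauge
eigenvalue; any value other than `1` would do. -/
lemma exists_circle_mul_conj_pow_eq {k : ℕ} (hk : k ≠ 1) :
    ∃ z : Circle, (z : ℂ) * star ((z : ℂ) ^ k) = -1 := by
  rcases k with _ | _ | k
  · exact ⟨Circle.exp Real.pi, by simp⟩
  · exact absurd rfl hk
  · refine ⟨Circle.exp (Real.pi / (k + 1)), ?_⟩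
    set z := Circle.exp (Real.pi / (k + 1)) with hz
    have h1 : (z : ℂ) ^ (k + 1) = -1 := by
      rw [hz, Circle.coe_exp, ← Complex.exp_nat_mul, ← Complex.exp_pi_mul_I]
      congr 1
      have : (k : ℂ) + 1 ≠ 0 := by exact_mod_cast k.succ_ne_zero
      push_cast
      field_simp
    have h2 : (z : ℂ) * star (z : ℂ) = 1 := by
      rw [RCLike.star_def, Complex.mul_conj]
      simp
    rw [pow_succ, star_mul, ← mul_assoc, h2, h1]
    simp

/-- An element of the fixed-point algebra preserves the summand of degree one. -/
lemma exists_oneParticle_eq [CompleteSpace E] {a : Toeplitz X E} (ha : a ∈ fixedAlgebra X E)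
    (ζ : E) : ∃ ξ : E, oneParticle X E ξ = a.1 (oneParticle X E ζ) := by
  refine mem_range_oneParticle fun w hw => ?_
  obtain ⟨z, hz⟩ := exists_circle_mul_conj_pow_eq hw
  have hcomm : gaugeUnitary X E z * a.1 = a.1 * gaugeUnitary X E z := by
    have h1 : gaugeUnitary X E z * a.1 * star (gaugeUnitary X E z) = a.1 := ha z
    calc gaugeUnitary X E z * a.1
        = gaugeUnitary X E z * a.1 * (star (gaugeUnitary X E z) * gaugeUnitary X E z) := by
          rw [gaugeUnitary_star_mul, mul_one]
      _ = a.1 * gaugeUnitary X E z := by rw [← mul_assoc, h1]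
  have hb : gaugeUnitary X E z (a.1 (oneParticle X E ζ)) =
      ContinuousMap.const X (z : ℂ) • a.1 (oneParticle X E ζ) := by
    change (gaugeUnitary X E z * a.1) (oneParticle X E ζ) = _
    rw [hcomm, Adjointable.mul_apply, oneParticle_eq_tensor, gaugeUnitary_tensor,
      Adjointable.map_smul', List.length_singleton, pow_one]
  generalize a.1 (oneParticle X E ζ) = b at hb
  -- The gauge unitary preserves inner products, while the two vectors have eigenvalues `z ^ k` and
  -- `z`. By the choice of `z` their inner product equals its own negative.
  have h1 : inner C(X, ℂ) (gaugeUnitary X E z (Fock.tensor X w)) (gaugeUnitary X E z b) =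
      inner C(X, ℂ) (Fock.tensor X w) b := by
    rw [Adjointable.inner_left]
    change inner C(X, ℂ) _ ((star (gaugeUnitary X E z) * gaugeUnitary X E z) b) = _
    rw [gaugeUnitary_star_mul, Adjointable.one_apply]
  rw [hb, gaugeUnitary_tensor] at h1
  ext x
  have h2 := DFunLike.congr_fun ((inner_smul_smul _ _ _ _).symm.trans h1) x
  simp only [ContinuousMap.mul_apply, ContinuousMap.const_apply, ContinuousMap.star_apply] at h2
  rw [mul_right_comm, hz] at h2
  rw [ContinuousMap.zero_apply]
  linear_combination (-1 / 2 : ℂ) * h2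

end OneParticle

/-! ### Extension of unit sections and proper infiniteness of `𝓣(E)`. -/

section Lifting

variable {X : Type*} [TopologicalSpace X] [CompactSpace X] [T2Space X] {E : Type*}
  [NormedAddCommGroup E] [NormedSpace ℂ E] [Module C(X, ℂ) E] [CStarModule C(X, ℂ) E]

open SectionRestriction in
/-- Unit sections on closed sets which agree on the intersection can be deformed to a unit section
on the union. -/
lemma exists_unit_on_union {G F : Set X} (hG : IsClosed G) (hF : IsClosed F) {a b : E}
    (ha : ∀ y ∈ G, sqNorm a y = 1) (hb : ∀ y ∈ F, sqNorm b y = 1)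
    (hab : ∀ y ∈ G ∩ F, sqNorm (a - b) y = 0) : ∃ c : E, ∀ y ∈ G ∪ F, sqNorm c y = 1 := by
  let N : Set X := {y | sqNorm (a - b) y < 1 / 4}
  have hN : IsOpen N := isOpen_lt (sqNorm (a - b)).continuous continuous_const
  -- The interpolation `φ a + (1 - φ) b` equals `b` on `F ∖ N` and `a` on `G ∖ N`. On `N` it is
  -- within `1 / 2` of a unit vector, so it vanishes nowhere on `G ∪ F`.
  obtain ⟨φ, hφ0, hφ1, hφ⟩ := exists_continuous_zero_one_of_isClosed (hF.sdiff hN) (hG.sdiff hN) (by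
    rw [Set.disjoint_left]
    rintro y ⟨hyF, hyN⟩ ⟨hyG, -⟩
    exact hyN (by change sqNorm (a - b) y < 1 / 4; rw [hab y ⟨hyG, hyF⟩]; norm_num))
  have key (y : X) (hy : y ∈ G ∪ F) : 0 < sqNorm (ofRealFun φ • (a - b) + b) y := by
    rw [← norm_mk_sq]
    refine pow_pos ?_ 2
    have hd : y ∈ N → ‖(mk {y} (a - b) : Fibre E y)‖ ≤ 1 / 2 := fun h => by
      have h : sqNorm (a - b) y < 1 / 4 := h
      rw [← norm_mk_sq] at h
      nlinarith [norm_nonneg (mk {y} (a - b) : Fibre E y)]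
    have hd0 := norm_nonneg (mk {y} (a - b) : Fibre E y)
    obtain ⟨h0, h1⟩ := hφ y
    have hc : (mk {y} (ofRealFun φ • (a - b) + b) : Fibre E y) =
        (φ y : ℂ) • (mk {y} (a - b) : Fibre E y) + mk {y} b := by
      rw [map_add, mk_smul, ofRealFun_apply]
    rcases hy with hy | hy
    · have e : (mk {y} a : Fibre E y) = mk {y} (ofRealFun φ • (a - b) + b) +
          ((1 - φ y : ℝ) : ℂ) • (mk {y} (a - b) : Fibre E y) := by
        rw [hc, map_sub]
        push_cast
        module
      have h2 := norm_add_le (mk {y} (ofRealFun φ • (a - b) + b) : Fibre E y)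
        (((1 - φ y : ℝ) : ℂ) • (mk {y} (a - b) : Fibre E y))
      rw [← e, (norm_mk_eq_one_iff a y).2 (ha y hy), norm_smul, Complex.norm_real,
        Real.norm_of_nonneg (by linarith)] at h2
      by_cases hyN : y ∈ N
      · nlinarith [hd hyN]
      · have : φ y = 1 := hφ1 ⟨hy, hyN⟩
        rw [this] at h2
        linarith
    · have e : (mk {y} b : Fibre E y) = mk {y} (ofRealFun φ • (a - b) + b) +
          ((-φ y : ℝ) : ℂ) • (mk {y} (a - b) : Fibre E y) := by
        rw [hc]
        push_cast
        module
      have h2 := norm_add_le (mk {y} (ofRealFun φ • (a - b) + b) : Fibre E y)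
        (((-φ y : ℝ) : ℂ) • (mk {y} (a - b) : Fibre E y))
      rw [← e, (norm_mk_eq_one_iff b y).2 (hb y hy), norm_smul, Complex.norm_real, norm_neg,
        Real.norm_of_nonneg h0] at h2
      by_cases hyN : y ∈ N
      · nlinarith [hd hyN]
      · have : φ y = 0 := hφ0 ⟨hy, hyN⟩
        rw [this] at h2
        linarith
  obtain ⟨f, hf, -⟩ := exists_smul_unit (hG.union hF) key
  exact ⟨_, hf⟩

omit [T2Space X] in
lemma inner_apply_apply_of_unitary {F : Set X} {a : Toeplitz X E}
    (ha : Restriction.mk F a ∈ unitary (Restriction (Toeplitz X E) F)) {x : X} (hx : x ∈ F)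
    (b : Fock X E) : inner C(X, ℂ) (a.1 b) (a.1 b) x = inner C(X, ℂ) b b x := by
  have h : star a * a - 1 ∈ vanishingIdeal (Toeplitz X E) F := by
    rw [← Restriction.mk_eq_zero_iff, map_sub, map_one, map_mul, ← Restriction.star_mk, ha.1,
      sub_self]
  have h1 := inner_apply_eq_zero_of_mem_vanishingIdeal h b b hx
  have h2 : (star a * a - 1).1 b = star a.1 (a.1 b) - b := by
    rw [sub_eq_add_neg, sub_eq_add_neg]
    rfl
  have h3 : inner C(X, ℂ) b (star a.1 (a.1 b) - b) =
      inner C(X, ℂ) b (star a.1 (a.1 b)) - inner C(X, ℂ) b b :=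
    CStarModule.inner_sub_right (A := C(X, ℂ)) (E := Fock X E)
  rw [h2, h3, ← Adjointable.inner_left, ContinuousMap.sub_apply, sub_eq_zero] at h1
  exact h1

/-- The new section on `F (l + 1)` is `a* ζ (l + 1)`, with `a` a gauge invariant representative of
the lift. Only the restriction of `a` is unitary, so norms are controlled over `F (l + 1)` alone.
The final section need not extend `ξ`. -/
lemma IsAdaptedCover.exists_unit_section_succ [CompleteSpace E] {m : ℕ} {F : Fin m → Set X}
    {ζ : Fin m → E} (h : IsAdaptedCover F ζ) {l : ℕ} (hl : l + 1 < m) {ξ : E}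
    (hξ : ∀ y ∈ partialUnion F l, sqNorm ξ y = 1) {w : Restriction (Toeplitz X E) (overlap F l hl)}
    (hw : IsConnecting F ζ l hl (SectionRestriction.mk _ ξ) w) (hlift : LiftsToFixed F l hl w) :
    ∃ ξ' : E, ∀ y ∈ partialUnion F (l + 1), sqNorm ξ' y = 1 := by
  obtain ⟨_, hz, ⟨a, ha, rfl⟩, rfl⟩ := hlift
  obtain ⟨ξ', hξ'⟩ := exists_oneParticle_eq (star_mem ha) (ζ ⟨l + 1, hl⟩)
  have hunit : ∀ y ∈ F ⟨l + 1, hl⟩, sqNorm ξ' y = 1 := by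
    intro y hy
    have h1 := inner_apply_apply_of_unitary (a := star a) (F := F ⟨l + 1, hl⟩)
      (by rw [← Restriction.star_mk]; exact Unitary.star_mem hz) hy (oneParticle X E (ζ ⟨l + 1, hl⟩))
    rw [← hξ', inner_oneParticle, inner_oneParticle] at h1
    rw [← h.sqNorm_eq_one _ hy]
    exact congrArg Complex.re h1
  have hagree : ∀ y ∈ partialUnion F l ∩ F ⟨l + 1, hl⟩, sqNorm (ξ - ξ') y = 0 := by
    intro y hy
    -- Since `w ℓ(ξ) = ℓ(ζ (l + 1))` with `w` unitary, `ℓ(ξ) = w* ℓ(ζ (l + 1))` over the overlap;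
    -- applied to the vacuum this says that `ξ` and `ξ'` agree there.
    have hmem : ell X ξ - star a * ell X (ζ ⟨l + 1, hl⟩) ∈
        vanishingIdeal (Toeplitz X E) (overlap F l hl) := by
      have hc : Restriction.mk (overlap F l hl) a * Restriction.mk (overlap F l hl) (ell X ξ) =
          Restriction.mk (overlap F l hl) (ell X (ζ ⟨l + 1, hl⟩)) := hw.carry
      have hu : star (Restriction.mk (overlap F l hl) a) * Restriction.mk (overlap F l hl) a = 1 :=
        hw.unitary.1
      rw [← Restriction.mk_eq_zero_iff, map_sub, map_mul, sub_eq_zero, ← hc,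
        ← Restriction.star_mk, ← mul_assoc, hu, one_mul]
    have h2 : oneParticle X E (ξ - ξ') =
        (ell X ξ - star a * ell X (ζ ⟨l + 1, hl⟩)).1 (Fock.tensor X []) := by
      rw [map_sub, hξ', sub_eq_add_neg, sub_eq_add_neg]
      rfl
    have h1 := inner_apply_eq_zero_of_mem_vanishingIdeal hmem (oneParticle X E (ξ - ξ'))
      (Fock.tensor X []) hy
    rw [← h2, inner_oneParticle] at h1
    exact congrArg Complex.re h1
  obtain ⟨c, hc⟩ := exists_unit_on_union (isClosed_partialUnion h.isClosed l) (h.isClosed _) hξ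
    hunit hagree
  refine ⟨c, fun y hy => hc y ?_⟩
  obtain ⟨j, hj, hy⟩ := Set.mem_iUnion₂.1 hy
  rcases Nat.lt_or_ge l j.val with hlj | hlj
  · have : j = ⟨l + 1, hl⟩ := Fin.ext (by change j.val = l + 1; omega)
    exact Or.inr (this ▸ hy)
  · exact Or.inl (Set.mem_iUnion₂.2 ⟨j, hlj, hy⟩)

/-- If there is a global unit section then `𝓣(E)` is properly infinite. -/
lemma isProperlyInfinite_one_of_unit_section [Nonempty X]
    (hE : ∀ x : X, ¬ FiniteDimensional ℂ (Fibre E x)) {ξ : E} (hξ : ∀ x : X, sqNorm ξ x = 1) :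
    IsProperlyInfinite (1 : Toeplitz X E) := by
  obtain ⟨S, f, hS, hSS, hf⟩ := exists_orthogonal_isometry hE isClosed_univ (ξ := ξ)
    fun x _ => by rw [hξ x]; exact one_pos
  have hf1 : f = 1 := ContinuousMap.ext fun x => hf x (Set.mem_univ x)
  have hξ1 : inner C(X, ℂ) ξ ξ = 1 := by
    ext x
    rw [inner_self_apply, hξ]
    simp
  refine ⟨IsStarProjection.one _, fun h => ?_, ell X ξ, S, ?_, ?_, one_mul _, one_mul _, hS⟩
  · exact nontrivial_restriction (E := E) (F := (Set.univ : Set X)) Set.univ_nonempty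
      (by rw [← map_one (Restriction.mk Set.univ), h, map_zero])
  · rw [star_ell_mul_ell, hξ1, map_one]
  · rw [hSS, hf1, map_one]

lemma IsAdaptedCover.exists_unit_section [CompleteSpace E] [Nonempty X] {m : ℕ}
    {F : Fin m → Set X} {ζ : Fin m → E} (h : IsAdaptedCover F ζ)
    (hlift : ∀ (l : ℕ) (hl : l + 1 < m) (ξ : SectionRestriction E (partialUnion F l)),
      (∀ y : partialUnion F l, ‖ξ.eval y‖ = 1) →
        ∃ w : Restriction (Toeplitz X E) (overlap F l hl),
          IsConnecting F ζ l hl ξ w ∧ LiftsToFixed F l hl w) :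
    ∃ ξ : E, ∀ x : X, sqNorm ξ x = 1 := by
  have hind (l : ℕ) (hl : l < m) : ∃ ξ : E, ∀ y ∈ partialUnion F l, sqNorm ξ y = 1 := by
    induction l with
    | zero =>
      refine ⟨ζ ⟨0, hl⟩, fun y hy => ?_⟩
      obtain ⟨j, hj, hy⟩ := Set.mem_iUnion₂.1 hy
      have : j = ⟨0, hl⟩ := Fin.ext (Nat.le_zero.1 hj)
      exact h.sqNorm_eq_one _ (this ▸ hy)
    | succ l ih =>
      obtain ⟨ξ, hξ⟩ := ih (Nat.lt_of_succ_lt hl)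
      obtain ⟨w, hw, hw'⟩ := hlift l hl (SectionRestriction.mk _ ξ)
        fun y => (norm_mk_eq_one_iff ξ (y : X)).2 (hξ y y.2)
      exact h.exists_unit_section_succ hl hξ hw hw'
  obtain ⟨x₀⟩ := ‹Nonempty X›
  obtain ⟨k, -⟩ := Set.mem_iUnion.1 (h.cover.ge (Set.mem_univ x₀))
  -- Indices start at `0`, so the union up to `m - 1` is all of `X`; `m` is positive because `X` is
  -- nonempty.
  obtain ⟨ξ, hξ⟩ := hind (m - 1) (by have := k.2; omega)
  refine ⟨ξ, fun x => hξ x ?_⟩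
  obtain ⟨j, hj⟩ := Set.mem_iUnion.1 (h.cover.ge (Set.mem_univ x))
  exact Set.mem_iUnion₂.2 ⟨j, by have := j.2; omega, interior_subset hj⟩

end Lifting

end PimsnerToeplitz

theorem proposition5p2 {X : Type*} [TopologicalSpace X] [CompactSpace X] [T2Space X]
    [SecondCountableTopology X] [PerfectSpace X] [Nonempty X]
    {E : Type*} [NormedAddCommGroup E] [NormedSpace ℂ E] [Module C(X, ℂ) E]
    [CStarModule C(X, ℂ) E] [CompleteSpace E] [TopologicalSpace.SeparableSpace E]
    (hE : ∀ x : X, ¬ FiniteDimensional ℂ (Fibre E x)) :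
    (∃ (m : ℕ) (F : Fin m → Set X) (ζ : Fin m → E), IsAdaptedCover F ζ) ∧
    ∀ (m : ℕ) (F : Fin m → Set X) (ζ : Fin m → E), IsAdaptedCover F ζ →
      (∀ (l : ℕ) (hl : l + 1 < m) (ξ : SectionRestriction E (partialUnion F l)),
        (∀ y : partialUnion F l, (y : X) ∈ overlap F l hl → ‖ξ.eval y‖ = 1) →
          ∃ w : Restriction (Toeplitz X E) (overlap F l hl), IsConnecting F ζ l hl ξ w) ∧
      ((∀ (l : ℕ) (hl : l + 1 < m) (ξ : SectionRestriction E (partialUnion F l)),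
        (∀ y : partialUnion F l, ‖ξ.eval y‖ = 1) →
          ∃ w : Restriction (Toeplitz X E) (overlap F l hl),
            IsConnecting F ζ l hl ξ w ∧ LiftsToFixed F l hl w) →
        (∃ ξ : E, ∀ x : X, ‖(SectionRestriction.mk {x} ξ : Fibre E x)‖ = 1) ∧
        IsProperlyInfinite (1 : Toeplitz X E)) := by
  refine ⟨exists_isAdaptedCover hE, fun m F ζ h => ⟨h.exists_isConnecting hE, fun hlift => ?_⟩⟩
  obtain ⟨ξ, hξ⟩ := h.exists_unit_section hlift
  exact ⟨⟨ξ, fun x => (norm_mk_eq_one_iff ξ x).2 (hξ x)⟩,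
    isProperlyInfinite_one_of_unit_section hE hξ⟩
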